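/- A (discrete-time) \emph{subproduct system of two-dimensional Hilbert spaces} consists of two-dimensional complex Hilbert spaces $E_t$ ($t=1,2,\dots$) and isometric linear maps $\beta_{s,t}:E_{s+t}\to E_s\otimes E_t$ ($s,t\in\{1,2,\dots\}$) such that $$(\beta_{r,s}\otimes 1_{E_t})\,\beta_{r+s,t}=(1_{E_r}\otimes\beta_{s,t})\,\beta_{r,s+t}\qquad\text{for all } r,s,t\in\{1,2,\dots\}.$$ An \emph{isomorphism} from $(E_t,\beta_{s,t})$ to $(F_t,\gamma_{s,t})$ consists of unitary operators $\theta_t:E_t\to F_t$ such that $\gamma_{s,t}\theta_{s+t}=(\theta_s\otimes\theta_t)\beta_{s,t}$ for all $s,t$. A family of vectors $x_t,y_t\in E_t$ ($t=1,2,\dots$) is called a \emph{basis} of $(E_t,\beta_{s,t})$ - of type $\mathcal E_1(a)$, $a\in[0,1)$, if for all $s,t$: $\|x_t\|=\|y_t\|=1$, $\langle x_t,y_t\rangle=a^t$, $\beta_{s,t}(x_{s+t})=x_s\otimes x_t$, $\beta_{s,t}(y_{s+t})=y_s\otimes y_t$; - of type $\mathcal E_2(a)$, $a\in[0,1)$,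 if for all $s,t$: $\|x_t\|=\|y_t\|=1$, $\langle x_t,y_t\rangle=a^t$, and $\beta_{s,t}(x_{s+t})=x_s\otimes x_t$, $\beta_{s,t}(y_{s+t})=y_s\otimes y_t$ if $s$ is even, while $\beta_{s,t}(x_{s+t})=x_s\otimes y_t$, $\beta_{s,t}(y_{s+t})=y_s\otimes x_t$ if $s$ is odd; - of type $\mathcal E_3(\lambda)$, $\lambda\in\mathbb C\setminus\{0\}$, if for all $s,t$: $\|x_t\|=1$, $\|y_t\|^2=1+|\lambda|^2+|\lambda|^4+\dots+|\lambda|^{2t-2}$, $\langle x_t,y_t\rangle=0$, $\beta_{s,t}(x_{s+t})=x_s\otimes x_t$, $\beta_{s,t}(y_{s+t})=y_s\otimes x_t+\lambda^s x_s\otimes y_t$; - of type $\mathcal E_4$ if for all $s,t$: $\|x_t\|=\|y_t\|=1$, $\langle x_t,y_t\rangle=0$, $\beta_{s,t}(x_{s+t})=x_s\otimes x_t$, $\beta_{s,t}(y_{s+t})=y_s\otimes x_t$; - of type $\mathcal E_5$ if for all $s,t$: $\|x_t\|=\|y_t\|=1$, $\langle x_t,y_t\rangle=0$, $\beta_{s,t}(x_{s+t})=x_s\otimes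 x_t$, $\beta_{s,t}(y_{s+t})=x_s\otimes y_t$. The parameter $a$ or $\lambda$, if any, is part of the type. \textbf{Theorem.} (i) Every subproduct system of two-dimensional Hilbert spaces has a basis of one and only one of these types. (ii) For each type there exists a subproduct system having a basis of that type, and any two such systems are isomorphic. The subproduct system with a basis of a given type, which is thus unique up to isomorphism, is denoted by the name of the type. (iii) The subproduct systems $\mathcal E_1(a)$, $\mathcal E_2(a)$ ($a\in[0,1)$), $\mathcal E_3(\lambda)$ ($\lambda\in\mathbb C\setminus\{0\}$), $\mathcal E_4$, $\mathcal E_5$ are pairwise non-isomorphic. (iv) Every subproduct system of two-dimensional Hilbert spaces is isomorphic to one and only one of the subproduct systems listed in (iii). -/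

import Mathlib

open scoped TensorProduct InnerProductSpace

universe u v

/-- A discrete-time subproduct system of two-dimensional complex Hilbert spaces: spaces `E t` for
`t = 1, 2, …` and isometric linear maps `β_{s,t} : E_{s+t} → E_s ⊗ E_t` making the associativity
diagram commute. The map `β_{s,t}` is written `β (h : s + t = n) : E n → E s ⊗ E t`, so that
`E ((r + s) + t)` and `E (r + (s + t))` need not be identified by a cast; `β_{s,t}` itself is `β rfl`.
(The spaces are automatically complete, being finite-dimensional.) -/
structure SubproductSystem : Type (u + 1) where
  E : ℕ+ → Type u
  [normedAddCommGroup : ∀ t, NormedAddCommGroup (E t)]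
  [innerProductSpace : ∀ t, InnerProductSpace ℂ (E t)]
  finrank_eq_two : ∀ t, Module.finrank ℂ (E t) = 2
  β : ∀ {s t n : ℕ+}, s + t = n → (E n →ₗᵢ[ℂ] E s ⊗[ℂ] E t)
  assoc : ∀ {r s t rs st n : ℕ+} (hrs : r + s = rs) (hst : s + t = st)
    (h₁ : rs + t = n) (h₂ : r + st = n) (z : E n),
    TensorProduct.assoc ℂ (E r) (E s) (E t)
        (TensorProduct.map (β hrs).toLinearMap LinearMap.id (β h₁ z)) =
      TensorProduct.map LinearMap.id (β hst).toLinearMap (β h₂ z)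

namespace SubproductSystem

attribute [instance] normedAddCommGroup innerProductSpace

/-- An isomorphism of subproduct systems: unitary operators `θ_t : E_t → F_t` with
`γ_{s,t} θ_{s+t} = (θ_s ⊗ θ_t) β_{s,t}`. -/
structure Iso (S : SubproductSystem.{u}) (T : SubproductSystem.{v}) where
  θ : ∀ t, S.E t ≃ₗᵢ[ℂ] T.E t
  comm : ∀ {s t n : ℕ+} (h : s + t = n) (z : S.E n),
    T.β h (θ n z) =
      TensorProduct.map (θ s).toLinearEquiv.toLinearMap (θ t).toLinearEquiv.toLinearMap (S.β h z)

/-- Two subproduct systems are isomorphic. -/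
def IsIsomorphic (S : SubproductSystem.{u}) (T : SubproductSystem.{v}) : Prop :=
  Nonempty (Iso S T)

/-- The labels `𝓔₁(a)`, `𝓔₂(a)` for `a ∈ [0,1)`, `𝓔₃(lam)` for `lam ∈ ℂ ∖ {0}`, `𝓔₄`, `𝓔₅`. -/
inductive NormalForm : Type
  | E₁ (a : Set.Ico (0 : ℝ) 1)
  | E₂ (a : Set.Ico (0 : ℝ) 1)
  | E₃ (lam : {z : ℂ // z ≠ 0})
  | E₄
  | E₅

/-- The family `(x_t, y_t)` is a basis of the given type of the subproduct system `S`. -/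
def IsBasisOfType (S : SubproductSystem.{u}) (x y : ∀ t, S.E t) : NormalForm → Prop
  | .E₁ a =>
    (∀ t : ℕ+, ‖x t‖ = 1 ∧ ‖y t‖ = 1 ∧ ⟪x t, y t⟫_ℂ = (((a : ℝ) ^ (t : ℕ) : ℝ) : ℂ)) ∧
    ∀ {s t n : ℕ+} (h : s + t = n),
      S.β h (x n) = x s ⊗ₜ[ℂ] x t ∧ S.β h (y n) = y s ⊗ₜ[ℂ] y t
  | .E₂ a =>
    (∀ t : ℕ+, ‖x t‖ = 1 ∧ ‖y t‖ = 1 ∧ ⟪x t, y t⟫_ℂ = (((a : ℝ) ^ (t : ℕ) : ℝ) : ℂ)) ∧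
    ∀ {s t n : ℕ+} (h : s + t = n),
      (Even (s : ℕ) → S.β h (x n) = x s ⊗ₜ[ℂ] x t ∧ S.β h (y n) = y s ⊗ₜ[ℂ] y t) ∧
      (Odd (s : ℕ) → S.β h (x n) = x s ⊗ₜ[ℂ] y t ∧ S.β h (y n) = y s ⊗ₜ[ℂ] x t)
  | .E₃ lam =>
    (∀ t : ℕ+, ‖x t‖ = 1 ∧ ‖y t‖ ^ 2 = ∑ k ∈ Finset.range (t : ℕ), ‖(lam : ℂ)‖ ^ (2 * k) ∧
      ⟪x t, y t⟫_ℂ = 0) ∧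
    ∀ {s t n : ℕ+} (h : s + t = n),
      S.β h (x n) = x s ⊗ₜ[ℂ] x t ∧
      S.β h (y n) = y s ⊗ₜ[ℂ] x t + (lam : ℂ) ^ (s : ℕ) • (x s ⊗ₜ[ℂ] y t)
  | .E₄ =>
    (∀ t : ℕ+, ‖x t‖ = 1 ∧ ‖y t‖ = 1 ∧ ⟪x t, y t⟫_ℂ = 0) ∧
    ∀ {s t n : ℕ+} (h : s + t = n),
      S.β h (x n) = x s ⊗ₜ[ℂ] x t ∧ S.β h (y n) = y s ⊗ₜ[ℂ] x t
  | .E₅ =>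
    (∀ t : ℕ+, ‖x t‖ = 1 ∧ ‖y t‖ = 1 ∧ ⟪x t, y t⟫_ℂ = 0) ∧
    ∀ {s t n : ℕ+} (h : s + t = n),
      S.β h (x n) = x s ⊗ₜ[ℂ] x t ∧ S.β h (y n) = x s ⊗ₜ[ℂ] y t

/-- `S` has a basis of type `τ`, that is, `S` is (a copy of) the subproduct system named `τ`. -/
def HasBasisOfType (S : SubproductSystem.{u}) (τ : NormalForm) : Prop :=
  ∃ x y : ∀ t, S.E t, S.IsBasisOfType x y τ

end SubproductSystem

/-! The space `E 1` and the plane R = β_{1,1}(E_2) in E_1 ⊗ E_1 decide everything. Since the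
determinant is a quadratic form over ℂ, R contains a nonzero decomposable tensor, and this brings R
to one of four shapes (`pencil_normalForm`). Two of them are E_1 ⊗ b and a ⊗ E_1, which give types 4
and 5. For the other two, associativity places E_3 inside (R ⊗ E_1) ∩ (E_1 ⊗ R), and dim E_3 = 2
forces the left and right factors to span matching lines (`diagonal_pencil_cases`,
`jordan_pencil_eq_zero`); this yields types 1, 2 and 3. Rescaling, or Gram–Schmidt for types 3, 4
and 5, normalises the Gram matrix on E_1.

Such a basis of E_1 propagates to all t. For each of the five planes, associativity confines the
image of β_{1,n} to a plane with the same structure constants, and equality follows by dimension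
(`exists_next`). The remaining β_{s,t} follow by induction on s (`hasBasisOfType_of_one`).

Conversely, each list of structure constants is coassociative and compatible with its positive
definite Gram matrices, so a model exists, and these data determine the system up to isomorphism.
The type is unique because a change of basis of E_1 that respects R and the inner product cannot
alter it (`IsChangeOfBasis.eq`). -/

/-! ### Coordinates in tensor products of planes -/

section TensorComb

variable {V W X : Type*} [AddCommGroup V] [Module ℂ V] [AddCommGroup W] [Module ℂ W]
  [AddCommGroup X] [Module ℂ X]

/-- The tensor with coordinates `c` relative to the families `e` and `f`. -/
def tensorComb (c : Fin 2 → Fin 2 → ℂ) (e : Fin 2 → V) (f : Fin 2 → W) : V ⊗[ℂ] W :=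
  ∑ j, ∑ k, c j k • (e j ⊗ₜ[ℂ] f k)

theorem exists_basis_of_linearIndependent (hV : Module.finrank ℂ V = 2) {e : Fin 2 → V}
    (he : LinearIndependent ℂ e) : ∃ b : Module.Basis (Fin 2) ℂ V, ⇑b = e :=
  ⟨basisOfLinearIndependentOfCardEqFinrank he (by simp [hV]), by simp⟩

theorem exists_eq_sum_smul (hV : Module.finrank ℂ V = 2) {e : Fin 2 → V}
    (he : LinearIndependent ℂ e) (v : V) : ∃ α : Fin 2 → ℂ, v = ∑ i, α i • e i := by
  obtain ⟨b, rfl⟩ := exists_basis_of_linearIndependent hV he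
  exact ⟨b.repr v, (b.sum_repr v).symm⟩

theorem tensorComb_eq_sum_basis (b : Module.Basis (Fin 2) ℂ V) (b' : Module.Basis (Fin 2) ℂ W)
    (c : Fin 2 → Fin 2 → ℂ) :
    tensorComb c b b' = ∑ p : Fin 2 × Fin 2, c p.1 p.2 • b.tensorProduct b' p := by
  simp [tensorComb, Fintype.sum_prod_type, Module.Basis.tensorProduct_apply]

theorem exists_eq_tensorComb (hV : Module.finrank ℂ V = 2) (hW : Module.finrank ℂ W = 2)
    {e : Fin 2 → V} {f : Fin 2 → W} (he : LinearIndependent ℂ e) (hf : LinearIndependent ℂ f)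
    (w : V ⊗[ℂ] W) : ∃ c, w = tensorComb c e f := by
  obtain ⟨b, rfl⟩ := exists_basis_of_linearIndependent hV he
  obtain ⟨b', rfl⟩ := exists_basis_of_linearIndependent hW hf
  refine ⟨fun j k => (b.tensorProduct b').repr w (j, k), ?_⟩
  rw [tensorComb_eq_sum_basis]
  exact ((b.tensorProduct b').sum_repr w).symm

theorem tensorComb_injective (hV : Module.finrank ℂ V = 2) (hW : Module.finrank ℂ W = 2)
    {e : Fin 2 → V} {f : Fin 2 → W} (he : LinearIndependent ℂ e) (hf : LinearIndependent ℂ f)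
    {c c' : Fin 2 → Fin 2 → ℂ} (h : tensorComb c e f = tensorComb c' e f) : c = c' := by
  obtain ⟨b, rfl⟩ := exists_basis_of_linearIndependent hV he
  obtain ⟨b', rfl⟩ := exists_basis_of_linearIndependent hW hf
  rw [tensorComb_eq_sum_basis, tensorComb_eq_sum_basis] at h
  ext j k
  have h2 := congrArg (fun w => (b.tensorProduct b').repr w (j, k)) h
  simpa [Finsupp.single_apply] using h2

theorem sum_smul_tensorComb (α : Fin 2 → ℂ) (c : Fin 2 → Fin 2 → Fin 2 → ℂ) (e : Fin 2 → V)
    (f : Fin 2 → W) :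
    ∑ m, α m • tensorComb (c m) e f = tensorComb (fun j k => ∑ m, α m * c m j k) e f := by
  simp only [tensorComb, Fin.sum_univ_two, smul_add, smul_smul, add_smul]
  abel

theorem tensorComb_tmul_tmul (p q : Fin 2 → ℂ) (e : Fin 2 → V) (f : Fin 2 → W) :
    (∑ i, p i • e i) ⊗ₜ[ℂ] (∑ i, q i • f i) = tensorComb (fun j k => p j * q k) e f := by
  simp only [tensorComb, Fin.sum_univ_two, TensorProduct.add_tmul, TensorProduct.tmul_add,
    TensorProduct.smul_tmul_smul]
  abel

/-- The triple tensor with coordinates `c` relative to the families `e`, `f`, `g`. -/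
def tensorComb₃ (c : Fin 2 → Fin 2 → Fin 2 → ℂ) (e : Fin 2 → V) (f : Fin 2 → W) (g : Fin 2 → X) :
    V ⊗[ℂ] (W ⊗[ℂ] X) :=
  ∑ j, ∑ k, ∑ l, c j k l • (e j ⊗ₜ[ℂ] (f k ⊗ₜ[ℂ] g l))

theorem tensorComb₃_injective (hV : Module.finrank ℂ V = 2) (hW : Module.finrank ℂ W = 2)
    (hX : Module.finrank ℂ X = 2) {e : Fin 2 → V} {f : Fin 2 → W} {g : Fin 2 → X}
    (he : LinearIndependent ℂ e) (hf : LinearIndependent ℂ f) (hg : LinearIndependent ℂ g)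
    {c c' : Fin 2 → Fin 2 → Fin 2 → ℂ} (h : tensorComb₃ c e f g = tensorComb₃ c' e f g) :
    c = c' := by
  obtain ⟨b, rfl⟩ := exists_basis_of_linearIndependent hV he
  obtain ⟨b', rfl⟩ := exists_basis_of_linearIndependent hW hf
  obtain ⟨b'', rfl⟩ := exists_basis_of_linearIndependent hX hg
  have key : ∀ c, tensorComb₃ c b b' b'' = ∑ p : Fin 2 × Fin 2 × Fin 2,
      c p.1 p.2.1 p.2.2 • b.tensorProduct (b'.tensorProduct b'') p := by
    intro c
    simp [tensorComb₃, Fintype.sum_prod_type, Module.Basis.tensorProduct_apply]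
  rw [key, key] at h
  ext j k l
  have h2 := congrArg (fun w => (b.tensorProduct (b'.tensorProduct b'')).repr w (j, k, l)) h
  simpa [Finsupp.single_apply] using h2

theorem map_id_tensorComb {Y : Type*} [AddCommGroup Y] [Module ℂ Y] (φ : Y →ₗ[ℂ] W ⊗[ℂ] X)
    (e : Fin 2 → V) (y : Fin 2 → Y) (f : Fin 2 → W) (g : Fin 2 → X)
    {c : Fin 2 → Fin 2 → Fin 2 → ℂ} (hφ : ∀ i, φ (y i) = tensorComb (c i) f g)
    (P : Fin 2 → Fin 2 → ℂ) :
    TensorProduct.map LinearMap.id φ (tensorComb P e y) =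
      tensorComb₃ (fun j k l => ∑ i, P j i * c i k l) e f g := by
  simp only [tensorComb, tensorComb₃] at *
  simp only [map_add, map_smul, TensorProduct.map_tmul, LinearMap.id_apply, hφ,
    Fin.sum_univ_two, TensorProduct.tmul_add, TensorProduct.tmul_smul, smul_add, smul_smul,
    add_smul]
  abel

theorem assoc_map_tensorComb {Y : Type*} [AddCommGroup Y] [Module ℂ Y] (φ : Y →ₗ[ℂ] V ⊗[ℂ] W)
    (e : Fin 2 → V) (y : Fin 2 → Y) (f : Fin 2 → W) (g : Fin 2 → X)
    {c : Fin 2 → Fin 2 → Fin 2 → ℂ} (hφ : ∀ i, φ (y i) = tensorComb (c i) e f)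
    (Q : Fin 2 → Fin 2 → ℂ) :
    TensorProduct.assoc ℂ V W X (TensorProduct.map φ LinearMap.id (tensorComb Q y g)) =
      tensorComb₃ (fun j k l => ∑ m, Q m l * c m j k) e f g := by
  simp only [tensorComb, tensorComb₃] at *
  simp only [map_add, map_smul, TensorProduct.map_tmul, LinearMap.id_apply, hφ,
    Fin.sum_univ_two, TensorProduct.add_tmul, TensorProduct.smul_tmul', smul_add, smul_smul,
    add_smul, map_add, TensorProduct.assoc_tmul]
  simp only [← TensorProduct.smul_tmul']
  abel

theorem linearIndependent_tensorComb (hV : Module.finrank ℂ V = 2) (hW : Module.finrank ℂ W = 2)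
    {e : Fin 2 → V} {f : Fin 2 → W} (he : LinearIndependent ℂ e) (hf : LinearIndependent ℂ f)
    {c : Fin 2 → Fin 2 → Fin 2 → ℂ} (hc : LinearIndependent ℂ c) :
    LinearIndependent ℂ fun i => tensorComb (c i) e f := by
  rw [Fintype.linearIndependent_iff] at hc ⊢
  intro α hα
  apply hc α
  rw [sum_smul_tensorComb] at hα
  have h0 : tensorComb (fun _ _ => (0 : ℂ)) e f = 0 := by simp [tensorComb]
  have := tensorComb_injective hV hW he hf (hα.trans h0.symm)
  ext j k
  simpa using congrFun (congrFun this j) k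

end TensorComb

theorem inner_smul_tmul_smul_tmul {V W : Type*} [NormedAddCommGroup V] [InnerProductSpace ℂ V]
    [NormedAddCommGroup W] [InnerProductSpace ℂ W] (a b : ℂ) (x x' : V) (y y' : W) :
    ⟪a • (x ⊗ₜ[ℂ] y), b • (x' ⊗ₜ[ℂ] y')⟫_ℂ =
      (starRingEnd ℂ) a * b * (⟪x, x'⟫_ℂ * ⟪y, y'⟫_ℂ) := by
  refine (inner_smul_left (𝕜 := ℂ) (E := V ⊗[ℂ] W) _ _ _).trans ?_
  refine (congrArg _ (inner_smul_right (𝕜 := ℂ) (E := V ⊗[ℂ] W) _ _ _)).trans ?_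
  rw [TensorProduct.inner_tmul, mul_assoc]

theorem inner_tensorComb {V W : Type*} [NormedAddCommGroup V] [InnerProductSpace ℂ V]
    [NormedAddCommGroup W] [InnerProductSpace ℂ W] (c d : Fin 2 → Fin 2 → ℂ) (e : Fin 2 → V)
    (f : Fin 2 → W) :
    ⟪tensorComb c e f, tensorComb d e f⟫_ℂ = ∑ j, ∑ k, ∑ j', ∑ k',
      (starRingEnd ℂ) (c j k) * d j' k' * (⟪e j, e j'⟫_ℂ * ⟪f k, f k'⟫_ℂ) := by
  simp only [tensorComb, sum_inner]
  refine Finset.sum_congr rfl fun j _ => Finset.sum_congr rfl fun k _ => ?_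
  simp only [inner_sum]
  refine Finset.sum_congr rfl fun j' _ => Finset.sum_congr rfl fun k' _ => ?_
  exact inner_smul_tmul_smul_tmul _ _ _ _ _ _

/-! ### Structure constants and Gram matrices of the types -/

namespace SubproductSystem

namespace NormalForm

/-- The structure constants of a basis of type `τ`: with `e₀ = x` and `e₁ = y`,
`β_{s,t}(e_i) = ∑ coef τ s i j k • e_j ⊗ e_k`. -/
noncomputable def coef : NormalForm → ℕ → Fin 2 → Fin 2 → Fin 2 → ℂ
  | .E₁ _, _ => ![![![1, 0], ![0, 0]], ![![0, 0], ![0, 1]]]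
  | .E₂ _, s => if Even s then ![![![1, 0], ![0, 0]], ![![0, 0], ![0, 1]]]
      else ![![![0, 1], ![0, 0]], ![![0, 0], ![1, 0]]]
  | .E₃ lam, s => ![![![1, 0], ![0, 0]], ![![0, (lam : ℂ) ^ s], ![1, 0]]]
  | .E₄, _ => ![![![1, 0], ![0, 0]], ![![0, 0], ![1, 0]]]
  | .E₅, _ => ![![![1, 0], ![0, 0]], ![![0, 1], ![0, 0]]]

/-- The Gram matrix of a basis of type `τ`. -/
noncomputable def gram : NormalForm → ℕ → Fin 2 → Fin 2 → ℂ
  | .E₁ a, t => ![![1, (((a : ℝ) ^ t : ℝ) : ℂ)], ![(((a : ℝ) ^ t : ℝ) : ℂ), 1]]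
  | .E₂ a, t => ![![1, (((a : ℝ) ^ t : ℝ) : ℂ)], ![(((a : ℝ) ^ t : ℝ) : ℂ), 1]]
  | .E₃ lam, t => ![![1, 0], ![0, ((∑ k ∈ Finset.range t, ‖(lam : ℂ)‖ ^ (2 * k) : ℝ) : ℂ)]]
  | .E₄, _ => ![![1, 0], ![0, 1]]
  | .E₅, _ => ![![1, 0], ![0, 1]]

/-- Both sides are the coefficient of e_j ⊗ e_k ⊗ e_l in the image of e_i under the two composites
of the associativity diagram. No third index enters, because the constants of β_{s,t} depend on s
alone. -/
theorem coef_coassoc (τ : NormalForm) (r s : ℕ) (i j k l : Fin 2) :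
    ∑ m, coef τ (r + s) i m l * coef τ r m j k = ∑ m, coef τ r i j m * coef τ s m k l := by
  cases τ with
  | E₂ a =>
    by_cases hr : Even r <;> by_cases hs : Even s <;>
      fin_cases i <;> fin_cases j <;> fin_cases k <;> fin_cases l <;>
      simp [coef, Nat.even_add, hr, hs]
  | E₃ lam =>
    fin_cases i <;> fin_cases j <;> fin_cases k <;> fin_cases l <;> simp [coef, pow_add]
  | _ => fin_cases i <;> fin_cases j <;> fin_cases k <;> fin_cases l <;> simp [coef]

/-- This is what makes β_{s,t} isometric: the tensors prescribed as images of the basis vectors have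
the Gram matrix of level s + t. -/
theorem gram_add (τ : NormalForm) (s t : ℕ) (i i' : Fin 2) :
    gram τ (s + t) i i' = ∑ j, ∑ k, ∑ j', ∑ k',
      (starRingEnd ℂ) (coef τ s i j k) * coef τ s i' j' k' *
        (gram τ s j j' * gram τ t k k') := by
  cases τ with
  | E₂ a =>
    rcases Nat.even_or_odd s with hs | hs <;>
      fin_cases i <;> fin_cases i' <;> simp [coef, gram, hs, ← Nat.not_odd_iff_even, pow_add]
  | E₃ lam =>
    fin_cases i <;> fin_cases i' <;> simp [coef, gram]
    -- The geometric sum of length s + t is the one of length s plus |λ|^(2s) times the one of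
    -- length t.
    rw [Finset.sum_range_add, ← mul_pow, Complex.conj_mul', Finset.mul_sum, add_comm]
    congr 1
    refine Finset.sum_congr rfl fun k _ => ?_
    ring
  | _ => fin_cases i <;> fin_cases i' <;> simp [coef, gram, pow_add]

/-- The Gram matrices are real and positive definite. -/
theorem exists_gram_eq (τ : NormalForm) {t : ℕ} (ht : 0 < t) :
    ∃ g n : ℝ, gram τ t = ![![1, (g : ℂ)], ![(g : ℂ), (n : ℂ)]] ∧ g ^ 2 < n := by
  have key : ∀ a : Set.Ico (0 : ℝ) 1, ((a : ℝ) ^ t) ^ 2 < 1 := fun a => by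
    rw [← pow_mul]
    exact pow_lt_one₀ a.2.1 a.2.2 (by omega)
  cases τ with
  | E₁ a => exact ⟨(a : ℝ) ^ t, 1, by simp [gram], key a⟩
  | E₂ a => exact ⟨(a : ℝ) ^ t, 1, by simp [gram], key a⟩
  | E₃ lam =>
    refine ⟨0, ∑ k ∈ Finset.range t, ‖(lam : ℂ)‖ ^ (2 * k), by simp [gram], ?_⟩
    have h1 : (1 : ℝ) ≤ ∑ k ∈ Finset.range t, ‖(lam : ℂ)‖ ^ (2 * k) := by
      have := Finset.single_le_sum (f := fun k => ‖(lam : ℂ)‖ ^ (2 * k)) (s := Finset.range t)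
        (fun k _ => by positivity) (Finset.mem_range.2 ht)
      simpa using this
    linarith
  | E₄ => exact ⟨0, 1, by simp [gram], by norm_num⟩
  | E₅ => exact ⟨0, 1, by simp [gram], by norm_num⟩

theorem linearIndependent_coef (τ : NormalForm) (s : ℕ) : LinearIndependent ℂ (coef τ s) := by
  rw [Fintype.linearIndependent_iff]
  intro α hα
  have h : ∀ j k, ∑ i, α i * coef τ s i j k = 0 := fun j k => by
    simpa using congrFun (congrFun hα j) k
  have h00 := h 0 0
  have h01 := h 0 1
  have h10 := h 1 0
  have h11 := h 1 1
  intro i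
  cases τ with
  | E₂ a =>
    rcases Nat.even_or_odd s with hs | hs <;> fin_cases i <;>
      simp_all [coef, ← Nat.not_odd_iff_even]
  | _ => fin_cases i <;> simp_all [coef]

/-- The condition under which the image of `β_{1,1}` determines that of `β_{1,n}`. -/
theorem exists_eq_sum_coef (τ : NormalForm) {P : Fin 2 → Fin 2 → ℂ} {Q : Fin 2 → Fin 2 → ℂ}
    (h : ∀ j k l, ∑ i, P j i * coef τ 1 i k l = ∑ m, Q m l * coef τ 1 m j k) :
    ∃ α : Fin 2 → ℂ, P = fun j k => ∑ m, α m * coef τ 1 m j k := by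
  simp only [Fin.forall_fin_two, Fin.sum_univ_two] at h
  cases τ with
  | E₁ a =>
    refine ⟨![P 0 0, P 1 1], ?_⟩
    ext j k
    fin_cases j <;> fin_cases k <;> simp [coef] at h ⊢ <;> grind
  | E₂ a =>
    refine ⟨![P 0 1, P 1 0], ?_⟩
    ext j k
    fin_cases j <;> fin_cases k <;> simp [coef] at h ⊢ <;> grind
  | E₃ lam =>
    refine ⟨![P 0 0, P 1 0], ?_⟩
    have := lam.2
    ext j k
    fin_cases j <;> fin_cases k <;> simp [coef] at h ⊢ <;> grind
  | E₄ =>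
    refine ⟨![P 0 0, P 1 0], ?_⟩
    ext j k
    fin_cases j <;> fin_cases k <;> simp [coef] at h ⊢ <;> grind
  | E₅ =>
    refine ⟨![P 0 0, P 0 1], ?_⟩
    ext j k
    fin_cases j <;> fin_cases k <;> simp [coef] at h ⊢ <;> grind

end NormalForm

open NormalForm

/-- `IsBasisOfType` in terms of Gram matrices and structure constants. -/
theorem isBasisOfType_iff (S : SubproductSystem.{u}) (e : ∀ t, Fin 2 → S.E t) (τ : NormalForm) :
    S.IsBasisOfType (fun t => e t 0) (fun t => e t 1) τ ↔
      (∀ (t : ℕ+) i j, ⟪e t i, e t j⟫_ℂ = gram τ t i j) ∧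
      ∀ {s t n : ℕ+} (h : s + t = n) i, S.β h (e n i) = tensorComb (coef τ s i) (e s) (e t) := by
  have hn' : ∀ (t : ℕ+) i (r : ℝ), ‖e t i‖ ^ 2 = r ↔ ⟪e t i, e t i⟫_ℂ = (r : ℂ) :=
    fun t i r => by
      rw [inner_self_eq_norm_sq_to_K]
      exact Complex.ofReal_inj.symm.trans (by simp)
  have hn : ∀ (t : ℕ+) i, ‖e t i‖ = 1 ↔ ⟪e t i, e t i⟫_ℂ = 1 := fun t i => by
    rw [← Complex.ofReal_one, ← hn' t i 1, pow_eq_one_iff_of_nonneg (norm_nonneg _) two_ne_zero]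
  have hs : ∀ (t : ℕ+) (r : ℝ), ⟪e t 0, e t 1⟫_ℂ = (r : ℂ) ↔
      (⟪e t 0, e t 1⟫_ℂ = (r : ℂ) ∧ ⟪e t 1, e t 0⟫_ℂ = (r : ℂ)) := fun t r => by
    refine ⟨fun h => ⟨h, ?_⟩, fun h => h.1⟩
    rw [← inner_conj_symm, h, Complex.conj_ofReal]
  have hs0 : ∀ (t : ℕ+), ⟪e t 0, e t 1⟫_ℂ = 0 ↔
      (⟪e t 0, e t 1⟫_ℂ = 0 ∧ ⟪e t 1, e t 0⟫_ℂ = 0) := fun t => by simpa using hs t 0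
  cases τ with
  | E₁ a =>
    simp only [IsBasisOfType, hn, Fin.forall_fin_two, gram, coef, tensorComb,
      Fin.sum_univ_two]
    refine and_congr (forall_congr' fun t => ?_) ?_
    · have := hs t ((a : ℝ) ^ (t : ℕ))
      simp at this ⊢
      tauto
    · simp
  | E₂ a =>
    simp only [IsBasisOfType, hn, Fin.forall_fin_two, gram, coef, tensorComb,
      Fin.sum_univ_two]
    refine and_congr (forall_congr' fun t => ?_) ?_
    · have := hs t ((a : ℝ) ^ (t : ℕ))
      simp at this ⊢
      tauto
    · refine forall_congr' fun s => forall_congr' fun t => forall_congr' fun n =>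
        forall_congr' fun h => ?_
      by_cases hs : Even (s : ℕ) <;> simp [hs, ← Nat.not_even_iff_odd]
  | E₃ lam =>
    simp only [IsBasisOfType, hn, hn', Fin.forall_fin_two, gram, coef, tensorComb,
      Fin.sum_univ_two]
    refine and_congr (forall_congr' fun t => ?_) ?_
    · have := hs0 t
      simp at this ⊢
      tauto
    · simp [add_comm]
  | E₄ =>
    simp only [IsBasisOfType, hn, Fin.forall_fin_two, gram, coef, tensorComb,
      Fin.sum_univ_two]
    refine and_congr (forall_congr' fun t => ?_) ?_
    · have := hs0 t
      simp at this ⊢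
      tauto
    · simp
  | E₅ =>
    simp only [IsBasisOfType, hn, Fin.forall_fin_two, gram, coef, tensorComb,
      Fin.sum_univ_two]
    refine and_congr (forall_congr' fun t => ?_) ?_
    · have := hs0 t
      simp at this ⊢
      tauto
    · simp

theorem hasBasisOfType_iff (S : SubproductSystem.{u}) (τ : NormalForm) :
    S.HasBasisOfType τ ↔ ∃ e : ∀ t, Fin 2 → S.E t,
      (∀ (t : ℕ+) i j, ⟪e t i, e t j⟫_ℂ = gram τ t i j) ∧
      ∀ {s t n : ℕ+} (h : s + t = n) i,
        S.β h (e n i) = tensorComb (coef τ s i) (e s) (e t) := by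
  constructor
  · rintro ⟨x, y, h⟩
    exact ⟨fun t => ![x t, y t], (S.isBasisOfType_iff (fun t => ![x t, y t]) τ).1 h⟩
  · rintro ⟨e, h⟩
    exact ⟨_, _, (S.isBasisOfType_iff e τ).2 h⟩

end SubproductSystem

/-! ### Models of each type and their uniqueness up to isomorphism -/

namespace SubproductSystem

open NormalForm

theorem linearIndependent_of_inner_eq_gram {V : Type*} [NormedAddCommGroup V]
    [InnerProductSpace ℂ V] (τ : NormalForm) {t : ℕ} (ht : 0 < t) {e : Fin 2 → V}
    (h : ∀ i j, ⟪e i, e j⟫_ℂ = gram τ t i j) : LinearIndependent ℂ e := by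
  obtain ⟨g, n, hg, hn⟩ := exists_gram_eq τ ht
  rw [Fintype.linearIndependent_iff]
  intro α hα
  have h0 := congrArg (fun v => ⟪e 0, v⟫_ℂ) hα
  have h1 := congrArg (fun v => ⟪e 1, v⟫_ℂ) hα
  simp [-inner_self_eq_norm_sq_to_K, h, hg] at h0 h1
  have hne : (n : ℂ) - g ^ 2 ≠ 0 := by
    have : n - g ^ 2 ≠ 0 := by linarith
    exact_mod_cast this
  have h2 : α 1 = 0 := by
    have : α 1 * ((n : ℂ) - g ^ 2) = 0 := by linear_combination h1 - g * h0
    simpa [hne] using this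
  have h3 : α 0 = 0 := by simpa [h2] using h0
  intro i
  fin_cases i <;> assumption

theorem exists_linearIsometry_of_inner_eq {V W : Type*} [NormedAddCommGroup V]
    [InnerProductSpace ℂ V] [NormedAddCommGroup W] [InnerProductSpace ℂ W]
    (hV : Module.finrank ℂ V = 2) {e : Fin 2 → V} (he : LinearIndependent ℂ e) {f : Fin 2 → W}
    (h : ∀ i j, ⟪e i, e j⟫_ℂ = ⟪f i, f j⟫_ℂ) : ∃ φ : V →ₗᵢ[ℂ] W, ∀ i, φ (e i) = f i := by
  obtain ⟨b, rfl⟩ := exists_basis_of_linearIndependent hV he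
  refine ⟨(b.constr ℂ f).isometryOfInner fun x y => ?_, fun i => by simp⟩
  rw [← b.sum_repr x, ← b.sum_repr y]
  simp only [map_sum, map_smul, Module.Basis.constr_basis, sum_inner, inner_sum, inner_smul_left,
    inner_smul_right, h]

/-- Equal Gram matrices make the map of bases unitary, and equal structure constants make it
intertwine the β's. -/
theorem isIsomorphic_of_hasBasisOfType {τ : NormalForm} {S : SubproductSystem.{u}}
    {T : SubproductSystem.{v}} (hS : S.HasBasisOfType τ) (hT : T.HasBasisOfType τ) :
    S.IsIsomorphic T := by
  obtain ⟨e, he, he'⟩ := (hasBasisOfType_iff S τ).1 hS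
  obtain ⟨f, hf, hf'⟩ := (hasBasisOfType_iff T τ).1 hT
  have hli : ∀ t : ℕ+, LinearIndependent ℂ (e t) := fun t =>
    linearIndependent_of_inner_eq_gram τ t.pos (he t)
  choose φ hφ using fun t => exists_linearIsometry_of_inner_eq (S.finrank_eq_two t) (hli t)
    (f := f t) fun i j => (he t i j).trans (hf t i j).symm
  have : ∀ t, FiniteDimensional ℂ (S.E t) := fun t =>
    Module.finite_of_finrank_pos (by simp [S.finrank_eq_two])
  have : ∀ t, FiniteDimensional ℂ (T.E t) := fun t =>
    Module.finite_of_finrank_pos (by simp [T.finrank_eq_two])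
  refine ⟨⟨fun t => (φ t).toLinearIsometryEquiv
    ((S.finrank_eq_two t).trans (T.finrank_eq_two t).symm), ?_⟩⟩
  intro s t n h z
  obtain ⟨α, rfl⟩ := exists_eq_sum_smul (S.finrank_eq_two n) (hli n) z
  simp only [map_sum, map_smul, he' h]
  refine Finset.sum_congr rfl fun i _ => ?_
  simp [hφ, hf' h, tensorComb]

theorem HasBasisOfType.of_iso {τ : NormalForm} {S : SubproductSystem.{u}}
    {T : SubproductSystem.{v}} (hS : S.HasBasisOfType τ) (h : S.IsIsomorphic T) :
    T.HasBasisOfType τ := by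
  obtain ⟨e, he, he'⟩ := (hasBasisOfType_iff S τ).1 hS
  obtain ⟨Θ⟩ := h
  refine (hasBasisOfType_iff T τ).2 ⟨fun t i => Θ.θ t (e t i), fun t i j => by simp [he], ?_⟩
  intro s t n h i
  rw [Θ.comm h, he' h]
  simp [tensorComb]

theorem exists_inner_eq_gram (τ : NormalForm) {t : ℕ} (ht : 0 < t) :
    ∃ e : Fin 2 → EuclideanSpace ℂ (ULift.{v} (Fin 2)),
      ∀ i j, ⟪e i, e j⟫_ℂ = gram τ t i j := by
  obtain ⟨g, n, hg, hn⟩ := exists_gram_eq τ ht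
  have hsum : ∀ F : ULift.{v} (Fin 2) → ℂ, ∑ i, F i = F ⟨0⟩ + F ⟨1⟩ := fun F => by
    rw [← Equiv.ulift.symm.sum_comp, Fin.sum_univ_two]
    rfl
  have hsq : ((√(n - g ^ 2) : ℝ) : ℂ) * ((√(n - g ^ 2) : ℝ) : ℂ) = n - g ^ 2 := by
    rw [← Complex.ofReal_mul, Real.mul_self_sqrt (by linarith)]
    push_cast
    rfl
  -- The vectors (1, 0) and (g, √(n - g²)) realise the Gram matrix; positivity of the determinant
  -- makes the root real.
  refine ⟨![WithLp.toLp 2 fun k => ![1, 0] k.down,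
    WithLp.toLp 2 fun k => ![(g : ℂ), ((√(n - g ^ 2) : ℝ) : ℂ)] k.down], fun i j => ?_⟩
  fin_cases i <;> fin_cases j <;>
    simp [-inner_self_eq_norm_sq_to_K, PiLp.inner_apply, hsum, hg, hsq]
  ring

/-- All E_t are one fixed plane; only the chosen basis e_t varies with t. `gram_add` supplies the
isometries and `coef_coassoc` their associativity. -/
theorem exists_hasBasisOfType (τ : NormalForm) :
    ∃ S : SubproductSystem.{v}, S.HasBasisOfType τ := by
  let V := EuclideanSpace ℂ (ULift.{v} (Fin 2))
  have hV : Module.finrank ℂ V = 2 := by simp [V]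
  choose e he using fun t : ℕ+ => exists_inner_eq_gram.{v} τ t.pos
  have hli : ∀ t : ℕ+, LinearIndependent ℂ (e t) := fun t =>
    linearIndependent_of_inner_eq_gram τ t.pos (he t)
  have hφ : ∀ {s t n : ℕ+} (_ : s + t = n), ∃ φ : V →ₗᵢ[ℂ] V ⊗[ℂ] V,
      ∀ i, φ (e n i) = tensorComb (coef τ s i) (e s) (e t) := by
    intro s t n h
    refine exists_linearIsometry_of_inner_eq hV (hli n) fun i j => ?_
    rw [inner_tensorComb, he, ← h, PNat.add_coe, gram_add]
    simp only [he]
  choose φ hφ using @hφ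
  refine ⟨{ E := fun _ => V, finrank_eq_two := fun _ => hV, β := fun h => φ h, assoc := ?_ },
    (hasBasisOfType_iff _ τ).2 ⟨e, he, hφ⟩⟩
  intro r s t rs st n hrs hst h₁ h₂ z
  obtain ⟨α, rfl⟩ := exists_eq_sum_smul hV (hli n) z
  simp only [map_sum, map_smul, hφ, sum_smul_tensorComb]
  rw [assoc_map_tensorComb _ (e r) (e rs) (e s) (e t) (hφ hrs),
    map_id_tensorComb _ (e r) (e st) (e s) (e t) (hφ hst)]
  congr 1
  ext j k l
  simp only [Finset.sum_mul]
  rw [Finset.sum_comm]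
  conv_rhs => rw [Finset.sum_comm]
  refine Finset.sum_congr rfl fun i _ => ?_
  have := coef_coassoc τ r s i j k l
  simp only [mul_assoc, ← Finset.mul_sum]
  rw [← hrs, PNat.add_coe, this]

end SubproductSystem

/-! ### Propagation of a basis from levels 1 and 2 -/

namespace SubproductSystem

open NormalForm

section Recursion

variable (S : SubproductSystem.{u})

theorem β_injective {s t n : ℕ+} (h : s + t = n) : Function.Injective (S.β h) :=
  (S.β h).injective

/-- Associativity of a subproduct system in coordinates. -/
theorem assoc_coordinates {r s t rs st n : ℕ+} (hrs : r + s = rs) (hst : s + t = st)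
    (h₁ : rs + t = n) (h₂ : r + st = n) {er : Fin 2 → S.E r} {es : Fin 2 → S.E s}
    {et : Fin 2 → S.E t} {ers : Fin 2 → S.E rs} {est : Fin 2 → S.E st}
    (her : LinearIndependent ℂ er) (hes : LinearIndependent ℂ es) (het : LinearIndependent ℂ et)
    {c c' : Fin 2 → Fin 2 → Fin 2 → ℂ} (hc : ∀ i, S.β hrs (ers i) = tensorComb (c i) er es)
    (hc' : ∀ i, S.β hst (est i) = tensorComb (c' i) es et) {z : S.E n}
    {P Q : Fin 2 → Fin 2 → ℂ} (hP : S.β h₂ z = tensorComb P er est)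
    (hQ : S.β h₁ z = tensorComb Q ers et) (j k l : Fin 2) :
    ∑ i, P j i * c' i k l = ∑ m, Q m l * c m j k := by
  have h := S.assoc hrs hst h₁ h₂ z
  rw [hP, hQ, assoc_map_tensorComb _ er ers es et hc, map_id_tensorComb _ er est es et hc'] at h
  have := tensorComb₃_injective (S.finrank_eq_two r) (S.finrank_eq_two s) (S.finrank_eq_two t)
    her hes het h
  exact (congrFun (congrFun (congrFun this j) k) l).symm

/-- Dimension count: the range of the injective β is a plane inside the plane spanned by w, hence
equal to it. -/
theorem exists_β_eq_of_forall_mem_span {s t n : ℕ+} (h : s + t = n)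
    {w : Fin 2 → S.E s ⊗[ℂ] S.E t} (hw : LinearIndependent ℂ w)
    (hmem : ∀ z, ∃ α : Fin 2 → ℂ, S.β h z = ∑ i, α i • w i) :
    ∃ e : Fin 2 → S.E n, LinearIndependent ℂ e ∧ ∀ i, S.β h (e i) = w i := by
  have hle : LinearMap.range (S.β h).toLinearMap ≤ Submodule.span ℂ (Set.range w) := by
    rintro _ ⟨z, rfl⟩
    obtain ⟨α, hα⟩ := hmem z
    change S.β h z ∈ _
    rw [hα]
    exact Submodule.sum_mem _ fun i _ =>
      Submodule.smul_mem _ _ (Submodule.subset_span (Set.mem_range_self i))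
  have hfin : FiniteDimensional ℂ (Submodule.span ℂ (Set.range w)) :=
    FiniteDimensional.span_of_finite ℂ (Set.finite_range w)
  have heq : LinearMap.range (S.β h).toLinearMap = Submodule.span ℂ (Set.range w) := by
    refine Submodule.eq_of_le_of_finrank_eq hle ?_
    rw [LinearMap.finrank_range_of_inj (S.β_injective h), S.finrank_eq_two,
      finrank_span_eq_card hw, Fintype.card_fin]
  have hex : ∀ i, ∃ z, S.β h z = w i := fun i => by
    have : w i ∈ LinearMap.range (S.β h).toLinearMap := by
      rw [heq]
      exact Submodule.subset_span (Set.mem_range_self i)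
    exact this
  choose e he using hex
  refine ⟨e, ?_, he⟩
  refine LinearIndependent.of_comp (S.β h).toLinearMap ?_
  have : (S.β h).toLinearMap ∘ e = w := funext he
  rw [this]
  exact hw

/-- The induction step. Inside E_1 ⊗ E_1 ⊗ E_n, a vector of E_p lies both in E_1 ⊗ β(E_m) and in R ⊗
E_n, where R is the image of β_{1,1}; `exists_eq_sum_coef` then leaves only the required plane in
E_1 ⊗ E_m. -/
theorem exists_next {τ : NormalForm} {e₁ : Fin 2 → S.E 1} {e₂ : Fin 2 → S.E (1 + 1)}
    (h₁ : LinearIndependent ℂ e₁) (h₂ : LinearIndependent ℂ e₂)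
    (h₁₂ : ∀ i, S.β (rfl : (1 : ℕ+) + 1 = 1 + 1) (e₂ i) =
      tensorComb (coef τ 1 i) e₁ e₁)
    {n m p : ℕ+} (hm : 1 + n = m) (hp : 1 + m = p) {en : Fin 2 → S.E n} {em : Fin 2 → S.E m}
    (hen : LinearIndependent ℂ en) (hem : LinearIndependent ℂ em)
    (h : ∀ i, S.β hm (em i) = tensorComb (coef τ 1 i) e₁ en) :
    ∃ ep : Fin 2 → S.E p, LinearIndependent ℂ ep ∧
      ∀ i, S.β hp (ep i) = tensorComb (coef τ 1 i) e₁ em := by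
  have h2n : 1 + 1 + n = p := by
    rw [← hp, ← hm, ← add_assoc]
  refine S.exists_β_eq_of_forall_mem_span hp
    (linearIndependent_tensorComb (S.finrank_eq_two 1) (S.finrank_eq_two m) h₁ hem
      (linearIndependent_coef τ 1)) fun z => ?_
  obtain ⟨P, hP⟩ := exists_eq_tensorComb (S.finrank_eq_two 1) (S.finrank_eq_two m) h₁ hem
    (S.β hp z)
  obtain ⟨Q, hQ⟩ := exists_eq_tensorComb (S.finrank_eq_two (1 + 1)) (S.finrank_eq_two n) h₂ hen
    (S.β h2n z)
  obtain ⟨α, hα⟩ := exists_eq_sum_coef τ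
    (S.assoc_coordinates rfl hm h2n hp h₁ h₁ hen h₁₂ h hP hQ)
  exact ⟨α, by rw [hP, sum_smul_tensorComb, hα]⟩

theorem hasBasisOfType_of_one {τ : NormalForm} {e₁ : Fin 2 → S.E 1}
    (h₁ : ∀ i j, ⟪e₁ i, e₁ j⟫_ℂ = gram τ 1 i j)
    (h : ∀ i, ∃ z, S.β (rfl : (1 : ℕ+) + 1 = 1 + 1) z =
      tensorComb (coef τ 1 i) e₁ e₁) : S.HasBasisOfType τ := by
  have hli₁ : LinearIndependent ℂ e₁ := linearIndependent_of_inner_eq_gram τ one_pos h₁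
  choose e₂ he₂ using h
  have hli₂ : LinearIndependent ℂ e₂ := by
    refine LinearIndependent.of_comp (S.β rfl).toLinearMap ?_
    have : (S.β rfl).toLinearMap ∘ e₂ = fun i => tensorComb (coef τ 1 i) e₁ e₁ := funext he₂
    rw [this]
    exact linearIndependent_tensorComb (S.finrank_eq_two 1) (S.finrank_eq_two 1) hli₁ hli₁
      (linearIndependent_coef τ 1)
  -- Two consecutive bases are carried along, since the next one is built from both.
  let State : ℕ+ → Type u := fun n =>
    { p : (Fin 2 → S.E n) × (Fin 2 → S.E (n + 1)) //
      LinearIndependent ℂ p.1 ∧ LinearIndependent ℂ p.2 ∧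
      ∀ i, S.β (add_comm 1 n) (p.2 i) = tensorComb (coef τ 1 i) e₁ p.1 }
  have hnext : ∀ n (p : State n), ∃ q : State (n + 1), q.1.1 = p.1.2 := fun n p => by
    obtain ⟨e, he, he'⟩ := S.exists_next hli₁ hli₂ he₂ (add_comm 1 n) (add_comm 1 (n + 1))
      p.2.1 p.2.2.1 p.2.2.2
    exact ⟨⟨(p.1.2, e), p.2.2.1, he, he'⟩, rfl⟩
  choose next hnext using hnext
  let start : State 1 := ⟨(e₁, e₂), hli₁, hli₂, he₂⟩
  let state : ∀ n, State n := fun n => PNat.recOn n start next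
  have hstart : state 1 = start := PNat.recOn_one _ _
  have hsucc : ∀ n, state (n + 1) = next n (state n) := fun n => PNat.recOn_succ _ _ _
  let e : ∀ n, Fin 2 → S.E n := fun n => (state n).1.1
  have he1 : e 1 = e₁ := by simp only [e, hstart, start]
  have hli : ∀ n, LinearIndependent ℂ (e n) := fun n => (state n).2.1
  have hone : ∀ {t n : ℕ+} (h : 1 + t = n) i,
      S.β h (e n i) = tensorComb (coef τ 1 i) (e 1) (e t) := by
    intro t n h i
    obtain rfl : n = t + 1 := by rw [← h, add_comm]
    have : e (t + 1) = (state t).1.2 := by simp only [e, hsucc, hnext]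
    rw [this, he1]
    exact (state t).2.2.2 i
  refine (hasBasisOfType_iff S τ).2 ⟨e, ?_, ?_⟩
  · intro t
    induction t using PNat.recOn with
    | one =>
      rw [he1]
      exact h₁
    | succ t ih =>
      intro i j
      -- As β_{1,t} is isometric, the Gram matrix at level t + 1 can be computed in E_1 ⊗ E_t.
      rw [← (S.β (add_comm 1 t)).inner_map_map, hone, hone, inner_tensorComb, PNat.add_coe,
        add_comm (t : ℕ), PNat.one_coe, gram_add, he1]
      simp only [h₁, ih]
  · intro s
    induction s using PNat.recOn with
    | one =>
      intro t n h i
      exact hone h i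
    | succ s ih =>
      intro t n h i
      have h' : 1 + (s + t) = n := by rw [← h, add_comm s 1, add_assoc]
      obtain ⟨Q, hQ⟩ := exists_eq_tensorComb (S.finrank_eq_two (s + 1)) (S.finrank_eq_two t)
        (hli (s + 1)) (hli t) (S.β h (e n i))
      -- Associativity for (1, s, t) expresses the unknown β_{s+1,t} through β_{1,s}, β_{s,t} and
      -- β_{1,s+t}. The coefficients in `coef_coassoc` satisfy the same equations, and independence
      -- of the tensors `coef τ 1 m` makes the solution unique.
      have key := S.assoc_coordinates (add_comm 1 s) rfl h h' (hli 1) (hli s) (hli t)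
        (hone (add_comm 1 s)) (ih rfl) (hone h' i) hQ
      rw [hQ]
      congr 1
      have hc := Fintype.linearIndependent_iff.1 (linearIndependent_coef τ 1)
      ext m l
      refine sub_eq_zero.1 (hc (fun m => Q m l - coef τ (s + 1 : ℕ+) i m l) ?_ m)
      ext j k
      have h2 := (key j k l).symm.trans (coef_coassoc τ 1 s i j k l).symm
      rw [add_comm 1 (s : ℕ)] at h2
      simp only [sub_smul, Finset.sum_sub_distrib, Pi.sub_apply, Finset.sum_apply, Pi.smul_apply,
        smul_eq_mul, Pi.zero_apply, PNat.add_coe, PNat.one_coe]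
      exact sub_eq_zero.2 h2

end Recursion

end SubproductSystem

/-! ### Uniqueness of the type -/

theorem tensorComb_sum_smul {V : Type*} [AddCommGroup V] [Module ℂ V] (c A : Fin 2 → Fin 2 → ℂ)
    (e : Fin 2 → V) :
    tensorComb c (fun i => ∑ k, A i k • e k) (fun i => ∑ k, A i k • e k) =
      tensorComb (fun j k => ∑ a, ∑ b, c a b * A a j * A b k) e e := by
  simp only [tensorComb, Fin.sum_univ_two, TensorProduct.add_tmul, TensorProduct.tmul_add,
    TensorProduct.smul_tmul_smul, smul_add, smul_smul, add_smul, mul_assoc]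
  abel

namespace SubproductSystem

namespace NormalForm

/-- The change of basis `A` carries the span of the tensors `coef σ 1 i` into that of the
tensors `coef τ 1 i`, and the Gram matrix of `τ` to that of `σ`. -/
structure IsChangeOfBasis (σ τ : NormalForm) (A : Fin 2 → Fin 2 → ℂ) : Prop where
  det_ne_zero : A 0 0 * A 1 1 - A 0 1 * A 1 0 ≠ 0
  exists_coef : ∀ i, ∃ α : Fin 2 → ℂ, ∀ j k,
    ∑ a, ∑ b, coef σ 1 i a b * A a j * A b k = ∑ m, α m * coef τ 1 m j k
  gram_eq : ∀ i j, gram σ 1 i j = ∑ k, ∑ l, (starRingEnd ℂ) (A i k) * A j l * gram τ 1 k l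

/-- Moduli remove the unimodular factors p and q, and the parameters are nonnegative. -/
theorem eq_of_norm_eq_one {a b : Set.Ico (0 : ℝ) 1} {p q : ℂ}
    (hp : (starRingEnd ℂ) p * p = 1) (hq : (starRingEnd ℂ) q * q = 1)
    (h : ((a : ℝ) : ℂ) = (starRingEnd ℂ) p * q * ((b : ℝ) : ℂ)) : a = b := by
  have hn : ∀ {r : ℂ}, (starRingEnd ℂ) r * r = 1 → ‖r‖ = 1 := fun {r} hr => by
    rw [Complex.conj_mul'] at hr
    have : ‖r‖ ^ 2 = 1 := by exact_mod_cast hr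
    exact (pow_eq_one_iff_of_nonneg (norm_nonneg _) two_ne_zero).1 this
  have := congrArg norm h
  simp only [norm_mul, RCLike.norm_conj, hn hp, hn hq, Complex.norm_real, Real.norm_eq_abs,
    abs_of_nonneg a.2.1, abs_of_nonneg b.2.1, one_mul] at this
  exact Subtype.ext this

/-- The decomposable tensors in the plane tell the five families apart: two lines of squares, two
lines of swapped products, a single line, all v ⊗ x, all x ⊗ v. Within type 3, λ is the ratio of the
two mixed coefficients; within types 1 and 2, a is the modulus of the inner product. -/
theorem IsChangeOfBasis.eq {σ τ : NormalForm} {A : Fin 2 → Fin 2 → ℂ}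
    (h : IsChangeOfBasis σ τ A) : σ = τ := by
  obtain ⟨hdet, hcoef, hgram⟩ := h
  simp only [Fin.forall_fin_two, Fin.sum_univ_two] at hcoef hgram
  obtain ⟨⟨α, hα⟩, β, hβ⟩ := hcoef
  cases σ with
  | E₁ a =>
    cases τ with
    | E₁ b =>
      simp [coef, gram] at hα hβ hgram
      -- The two distinguished lines can only be kept or exchanged, so the change of basis is
      -- diagonal or antidiagonal.
      have h : A 0 0 = 0 ∧ A 1 1 = 0 ∨ A 0 1 = 0 ∧ A 1 0 = 0 := by grind
      congr 1
      rcases h with ⟨h, h'⟩ | ⟨h, h'⟩ <;> simp [h, h'] at hgram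
      · refine eq_of_norm_eq_one (p := A 0 1) (q := A 1 0) ?_ ?_ ?_ <;> grind
      · refine eq_of_norm_eq_one (p := A 0 0) (q := A 1 1) ?_ ?_ ?_ <;> grind
    | E₃ lam => have := lam.2; simp [coef] at hα hβ; grind
    | _ => simp [coef] at hα hβ; grind
  | E₂ a =>
    cases τ with
    | E₂ b =>
      simp [coef, gram] at hα hβ hgram
      have h : A 0 0 = 0 ∧ A 1 1 = 0 ∨ A 0 1 = 0 ∧ A 1 0 = 0 := by grind
      congr 1
      rcases h with ⟨h, h'⟩ | ⟨h, h'⟩ <;> simp [h, h'] at hgram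
      · refine eq_of_norm_eq_one (p := A 0 1) (q := A 1 0) ?_ ?_ ?_ <;> grind
      · refine eq_of_norm_eq_one (p := A 0 0) (q := A 1 1) ?_ ?_ ?_ <;> grind
    | E₃ lam => have := lam.2; simp [coef] at hα hβ; grind
    | _ => simp [coef] at hα hβ; grind
  | E₃ lam =>
    have := lam.2
    cases τ with
    | E₃ lam' =>
      have := lam'.2
      congr 1
      ext1
      simp [coef] at hα hβ
      grind
    | _ => simp [coef] at hα hβ; grind
  | E₄ =>
    cases τ with
    | E₃ lam => have := lam.2; simp [coef] at hα hβ; grind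
    | _ => simp [coef] at hα hβ; grind
  | E₅ =>
    cases τ with
    | E₃ lam => have := lam.2; simp [coef] at hα hβ; grind
    | _ => simp [coef] at hα hβ; grind

end NormalForm

open NormalForm

theorem HasBasisOfType.unique {S : SubproductSystem.{u}} {σ τ : NormalForm}
    (hσ : S.HasBasisOfType σ) (hτ : S.HasBasisOfType τ) : σ = τ := by
  obtain ⟨f, hf, hf'⟩ := (hasBasisOfType_iff S σ).1 hσ
  obtain ⟨e, he, he'⟩ := (hasBasisOfType_iff S τ).1 hτ
  have hlie : ∀ t, LinearIndependent ℂ (e t) := fun t =>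
    linearIndependent_of_inner_eq_gram τ t.pos (he t)
  have hlif := linearIndependent_of_inner_eq_gram σ one_pos (hf 1)
  choose A hA using fun i => exists_eq_sum_smul (S.finrank_eq_two 1) (hlie 1) (f 1 i)
  have hfA : f 1 = fun i => ∑ k, A i k • e 1 k := funext hA
  refine IsChangeOfBasis.eq (A := A) ⟨fun hdet => ?_, fun i => ?_, fun i j => ?_⟩
  -- A vanishing determinant gives linear relations between the two vectors of `f 1` whose
  -- coefficients are the entries of A; independence kills them, so `f 1 0` is zero.
  · have hc := Fintype.linearIndependent_iff.1 hlif
    have h1 := hc ![A 1 1, -A 0 1] (by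
      simp only [hA, Fin.sum_univ_two, Matrix.cons_val_zero, Matrix.cons_val_one, smul_add,
        smul_smul, neg_mul]
      have : A 1 1 * A 0 0 = A 0 1 * A 1 0 := by linear_combination hdet
      rw [this, mul_comm (A 1 1) (A 0 1), neg_smul, neg_smul]
      abel)
    have h2 := hc ![A 1 0, -A 0 0] (by
      simp only [hA, Fin.sum_univ_two, Matrix.cons_val_zero, Matrix.cons_val_one, smul_add,
        smul_smul, neg_mul]
      have : A 0 0 * A 1 1 = A 1 0 * A 0 1 := by linear_combination hdet
      rw [this, mul_comm (A 0 0) (A 1 0), neg_smul, neg_smul]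
      abel)
    have h3 : f 1 0 = 0 := by
      have h4 := h1 1
      have h5 := h2 1
      simp at h4 h5
      simp [hA, h4, h5]
    exact hlif.ne_zero 0 h3
  · obtain ⟨α, hα⟩ := exists_eq_sum_smul (S.finrank_eq_two (1 + 1)) (hlie (1 + 1))
      (f (1 + 1) i)
    refine ⟨α, fun j k => ?_⟩
    have h := hf' (rfl : (1 : ℕ+) + 1 = 1 + 1) i
    rw [hα, hfA, tensorComb_sum_smul, map_sum] at h
    simp only [map_smul, he', sum_smul_tensorComb] at h
    have := tensorComb_injective (S.finrank_eq_two 1) (S.finrank_eq_two 1) (hlie 1) (hlie 1) h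
    exact (congrFun (congrFun this j) k).symm
  · have h := hf 1 i j
    rw [hA, hA] at h
    simp only [sum_inner, inner_sum, inner_smul_left, inner_smul_right, he] at h
    rw [PNat.one_coe] at h
    rw [← h]
    simp only [Fin.sum_univ_two]
    ring

end SubproductSystem

/-! ### Planes of 2 × 2 matrices -/

section LinearAlgebra

/-- The determinant on the pencil is a binary quadratic form, which has a nontrivial zero over ℂ:
either (1, 0), or (x, 1) with x a root of a genuine quadratic. -/
theorem exists_det_smul_add_smul_eq_zero (A B : Fin 2 → Fin 2 → ℂ) :
    ∃ α : Fin 2 → ℂ, α ≠ 0 ∧ (α 0 * A 0 0 + α 1 * B 0 0) * (α 0 * A 1 1 + α 1 * B 1 1) =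
      (α 0 * A 0 1 + α 1 * B 0 1) * (α 0 * A 1 0 + α 1 * B 1 0) := by
  by_cases hA : A 0 0 * A 1 1 - A 0 1 * A 1 0 = 0
  · refine ⟨![1, 0], fun h => ?_, ?_⟩
    · simpa using congrFun h 0
    · simpa using sub_eq_zero.1 hA
  · obtain ⟨x, hx⟩ := exists_quadratic_eq_zero
      (b := A 0 0 * B 1 1 + B 0 0 * A 1 1 - A 0 1 * B 1 0 - B 0 1 * A 1 0)
      (c := B 0 0 * B 1 1 - B 0 1 * B 1 0) hA (IsAlgClosed.exists_eq_mul_self _)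
    refine ⟨![x, 1], fun h => ?_, ?_⟩
    · simpa using congrFun h 1
    · simp only [Matrix.cons_val_zero, Matrix.cons_val_one]
      linear_combination hx

theorem exists_eq_mul_of_det_eq_zero {M : Fin 2 → Fin 2 → ℂ}
    (h : M 0 0 * M 1 1 = M 0 1 * M 1 0) : ∃ p q : Fin 2 → ℂ, M = fun j k => p j * q k := by
  by_cases h0 : M 0 0 = 0
  · by_cases h1 : M 0 1 = 0
    · refine ⟨![0, 1], M 1, ?_⟩
      ext j k
      fin_cases j <;> fin_cases k <;> simp [h0, h1]
    · refine ⟨![1, M 1 1 / M 0 1], M 0, ?_⟩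
      ext j k
      fin_cases j <;> fin_cases k <;> simp <;> field_simp
      grind
  · refine ⟨![1, M 1 0 / M 0 0], M 0, ?_⟩
    ext j k
    fin_cases j <;> fin_cases k <;> simp <;> field_simp
    grind

variable {V U : Type*} [AddCommGroup V] [Module ℂ V] [AddCommGroup U] [Module ℂ U]

theorem exists_linearIndependent_pair (hV : Module.finrank ℂ V = 2) {a : V} (ha : a ≠ 0) :
    ∃ c, LinearIndependent ℂ ![a, c] :=
  exists_linearIndependent_pair_of_one_lt_finrank (by omega) ha

theorem linearIndependent_pair_smul_add {a c : V} (h : LinearIndependent ℂ ![a, c]) {s : ℂ}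
    (hs : s ≠ 0) (r : ℂ) : LinearIndependent ℂ ![a, s • c + r • a] := by
  rw [LinearIndependent.pair_iff] at h ⊢
  intro x y hxy
  obtain ⟨h1, h2⟩ := h (x + y * r) (y * s) (by rw [← hxy]; module)
  have hy : y = 0 := by simpa [hs] using h2
  exact ⟨by simpa [hy] using h1, hy⟩

theorem linearIndependent_pair_det {e : Fin 2 → V} (p q : Fin 2 → ℂ)
    (h : LinearIndependent ℂ ![∑ i, p i • e i, ∑ i, q i • e i]) :
    p 0 * q 1 - p 1 * q 0 ≠ 0 := by
  intro hdet
  rw [LinearIndependent.pair_iff] at h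
  have h1 := h (q 1) (-p 1) (by
    simp only [Fin.sum_univ_two]
    have : q 1 * p 0 = p 1 * q 0 := by linear_combination hdet
    rw [smul_add, smul_smul, this]
    module)
  have h2 := h (q 0) (-p 0) (by
    simp only [Fin.sum_univ_two]
    have : q 0 * p 1 = p 0 * q 1 := by linear_combination -hdet
    rw [smul_add, smul_smul, smul_smul, this]
    module)
  have h3 := h 1 0 (by
    simp only [Fin.sum_univ_two]
    have h4 := neg_eq_zero.1 h1.2
    have h5 := neg_eq_zero.1 h2.2
    simp [h4, h5])
  exact one_ne_zero h3.1

theorem exists_map_eq_tmul (hV : Module.finrank ℂ V = 2) (hU : Module.finrank ℂ U = 2)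
    {β : U →ₗ[ℂ] V ⊗[ℂ] V} (hβ : Function.Injective β) :
    ∃ z a b, z ≠ 0 ∧ a ≠ 0 ∧ b ≠ 0 ∧ β z = a ⊗ₜ[ℂ] b := by
  have : Module.Finite ℂ V := Module.finite_of_finrank_pos (by omega)
  have : Module.Finite ℂ U := Module.finite_of_finrank_pos (by omega)
  let bV := Module.finBasisOfFinrankEq ℂ V hV
  let bU := Module.finBasisOfFinrankEq ℂ U hU
  choose M hM using fun i => exists_eq_tensorComb hV hV bV.linearIndependent
    bV.linearIndependent (β (bU i))
  obtain ⟨α, hα, hdet⟩ := exists_det_smul_add_smul_eq_zero (M 0) (M 1)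
  have hz : ∑ m, α m • bU m ≠ 0 := fun h =>
    hα (funext (Fintype.linearIndependent_iff.1 bU.linearIndependent α h))
  obtain ⟨p, q, hpq⟩ := exists_eq_mul_of_det_eq_zero
    (M := fun j k => ∑ m, α m * M m j k) (by simpa using hdet)
  have hβz : β (∑ m, α m • bU m) = (∑ i, p i • bV i) ⊗ₜ[ℂ] (∑ i, q i • bV i) := by
    simp only [map_sum, map_smul, hM]
    rw [sum_smul_tensorComb, hpq, tensorComb_tmul_tmul]
  refine ⟨_, _, _, hz, fun h => hz ?_, fun h => hz ?_, hβz⟩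
  · rw [h, TensorProduct.zero_tmul] at hβz
    exact hβ (hβz.trans (map_zero β).symm)
  · rw [h, TensorProduct.tmul_zero] at hβz
    exact hβ (hβz.trans (map_zero β).symm)

/-- Normal forms of a pencil of `2 × 2` matrices. -/
theorem pencil_normalForm (hV : Module.finrank ℂ V = 2) (hU : Module.finrank ℂ U = 2)
    {β : U →ₗ[ℂ] V ⊗[ℂ] V} (hβ : Function.Injective β) :
    ∃ (f : Fin 2 → U) (a b c d : V), LinearIndependent ℂ f ∧ LinearIndependent ℂ ![a, c] ∧
      LinearIndependent ℂ ![b, d] ∧ β (f 0) = a ⊗ₜ b ∧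
      (β (f 1) = c ⊗ₜ d ∨ β (f 1) = c ⊗ₜ b ∨ β (f 1) = a ⊗ₜ d ∨
        β (f 1) = a ⊗ₜ d + c ⊗ₜ b) := by
  obtain ⟨z, a, b, hz, ha, hb, hzab⟩ := exists_map_eq_tmul hV hU hβ
  obtain ⟨z', hz'⟩ := exists_linearIndependent_pair hU hz
  obtain ⟨c, hc⟩ := exists_linearIndependent_pair hV ha
  obtain ⟨d, hd⟩ := exists_linearIndependent_pair hV hb
  obtain ⟨M, hM⟩ := exists_eq_tensorComb hV hV hc hd (β z')
  simp only [tensorComb, Fin.sum_univ_two, Matrix.cons_val_zero, Matrix.cons_val_one] at hM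
  have hf : ∀ r : ℂ, LinearIndependent ℂ ![z, z' + r • z] := fun r => by
    simpa using linearIndependent_pair_smul_add hz' one_ne_zero r
  have hscale : ∀ {x y : V} {s : ℂ}, LinearIndependent ℂ ![x, y] → s ≠ 0 →
      LinearIndependent ℂ ![x, s • y] := fun h hs => by
    simpa using linearIndependent_pair_smul_add h hs 0
  -- `M 1 1` is the coefficient of c ⊗ d. If it vanishes, subtracting a multiple of z leaves only
  -- the a ⊗ d and c ⊗ b terms, and the case depends on which of these survive.
  by_cases h11 : M 1 1 = 0
  · have hβ' : β (z' + (-M 0 0) • z) = a ⊗ₜ (M 0 1 • d) + (M 1 0 • c) ⊗ₜ b := by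
      rw [map_add, map_smul, hM, hzab, h11, TensorProduct.tmul_smul, ← TensorProduct.smul_tmul']
      module
    by_cases h01 : M 0 1 = 0
    · by_cases h10 : M 1 0 = 0
      · have h0 : β (z' + (-M 0 0) • z) = β 0 := by rw [hβ', h01, h10]; simp
        exact absurd (hβ h0) ((hf (-M 0 0)).ne_zero 1)
      · refine ⟨_, a, b, M 1 0 • c, d, hf (-M 0 0), hscale hc h10, hd, hzab, ?_⟩
        right; left
        simpa [h01] using hβ'
    · by_cases h10 : M 1 0 = 0
      · refine ⟨_, a, b, c, M 0 1 • d, hf (-M 0 0), hc, hscale hd h01, hzab, ?_⟩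
        right; right; left
        simpa [h10] using hβ'
      · refine ⟨_, a, b, M 1 0 • c, M 0 1 • d, hf (-M 0 0), hscale hc h10, hscale hd h01,
          hzab, ?_⟩
        right; right; right
        exact hβ'
  -- The multiple of z corrects the a ⊗ b coefficient so that the matrix becomes singular; it then
  -- factors as (M₁₁ c + M₀₁ a) ⊗ (d + (M₁₀ / M₁₁) b).
  · refine ⟨![z, z' + (M 0 1 * (M 1 0 / M 1 1) - M 0 0) • z], a, b, M 1 1 • c + M 0 1 • a,
      (1 : ℂ) • d + (M 1 0 / M 1 1) • b, hf _, linearIndependent_pair_smul_add hc h11 _,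
      linearIndependent_pair_smul_add hd one_ne_zero _, hzab, ?_⟩
    left
    simp only [Matrix.cons_val_one, Matrix.cons_val_zero, map_add, map_smul, hM, hzab,
      TensorProduct.add_tmul, TensorProduct.tmul_add, TensorProduct.smul_tmul_smul]
    rw [mul_div_cancel₀ _ h11]
    module

end LinearAlgebra

/-! ### Normalising a pair of independent vectors -/

/-- Both vectors are normalised and a phase w makes the inner product nonnegative; it is below 1 by
strict Cauchy–Schwarz. Only scalings are used, so the lines of a and c survive, as types 1 and 2
require. -/
theorem exists_smul_inner_eq {V : Type*} [NormedAddCommGroup V] [InnerProductSpace ℂ V] {a c : V}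
    (h : LinearIndependent ℂ ![a, c]) : ∃ (p q : ℂ) (r : Set.Ico (0 : ℝ) 1), p ≠ 0 ∧ q ≠ 0 ∧
      ⟪p • a, p • a⟫_ℂ = 1 ∧ ⟪q • c, q • c⟫_ℂ = 1 ∧ ⟪p • a, q • c⟫_ℂ = ((r : ℝ) : ℂ) ∧
      ⟪q • c, p • a⟫_ℂ = ((r : ℝ) : ℂ) := by
  have ha : a ≠ 0 := h.ne_zero 0
  have hc : c ≠ 0 := h.ne_zero 1
  have ha' : (‖a‖ : ℂ) ≠ 0 := by simpa using ha
  have hc' : (‖c‖ : ℂ) ≠ 0 := by simpa using hc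
  obtain ⟨w, hw, hw'⟩ : ∃ w : ℂ, ‖w‖ = 1 ∧ w * ⟪a, c⟫_ℂ = (‖⟪a, c⟫_ℂ‖ : ℂ) := by
    by_cases h0 : ⟪a, c⟫_ℂ = 0
    · exact ⟨1, by simp, by simp [h0]⟩
    · refine ⟨(‖⟪a, c⟫_ℂ‖ : ℂ) / ⟪a, c⟫_ℂ, ?_, by field_simp⟩
      rw [norm_div, Complex.norm_real, norm_norm, div_self (by simpa using h0)]
  have hlt : ‖⟪a, c⟫_ℂ‖ / (‖a‖ * ‖c‖) < 1 := by
    rw [div_lt_one (by positivity)]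
    refine lt_of_le_of_ne (norm_inner_le_norm a c) fun heq => ?_
    obtain ⟨s, -, hs⟩ := (norm_inner_eq_norm_iff ha hc).1 heq
    rw [LinearIndependent.pair_iff] at h
    have := (h s (-1) (by rw [hs]; module)).2
    norm_num at this
  have h4 : ⟪(‖a‖ : ℂ)⁻¹ • a, (w * (‖c‖ : ℂ)⁻¹) • c⟫_ℂ =
      ((‖⟪a, c⟫_ℂ‖ / (‖a‖ * ‖c‖) : ℝ) : ℂ) := by
    rw [inner_smul_left, inner_smul_right, map_inv₀, Complex.conj_ofReal]
    push_cast
    rw [← hw']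
    field_simp
  refine ⟨(‖a‖ : ℂ)⁻¹, w * (‖c‖ : ℂ)⁻¹, ⟨_, by positivity, hlt⟩, inv_ne_zero ha',
    mul_ne_zero (fun h => by simp [h] at hw) (inv_ne_zero hc'), ?_, ?_, h4, ?_⟩
  · rw [inner_self_eq_norm_sq_to_K, norm_smul]
    simp [ha]
  · rw [inner_self_eq_norm_sq_to_K, norm_smul]
    simp [hc, hw]
  · rw [← inner_conj_symm, h4, Complex.conj_ofReal]

theorem exists_orthonormal_of_linearIndependent {V : Type*} [NormedAddCommGroup V]
    [InnerProductSpace ℂ V] {a c : V} (h : LinearIndependent ℂ ![a, c]) :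
    ∃ p q r : ℂ, p ≠ 0 ∧ q ≠ 0 ∧ ⟪p • a, p • a⟫_ℂ = 1 ∧
      ⟪q • c + r • a, q • c + r • a⟫_ℂ = 1 ∧ ⟪p • a, q • c + r • a⟫_ℂ = 0 ∧
      ⟪q • c + r • a, p • a⟫_ℂ = 0 := by
  have ha : a ≠ 0 := h.ne_zero 0
  have ha' : ⟪a, a⟫_ℂ ≠ 0 := by simpa using ha
  set k : ℂ := -(⟪a, c⟫_ℂ / ⟪a, a⟫_ℂ) with hk
  have h0 : ⟪a, c + k • a⟫_ℂ = 0 := by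
    rw [inner_add_right, inner_smul_right, hk]
    field_simp
    ring
  have hli := linearIndependent_pair_smul_add h one_ne_zero k
  rw [one_smul] at hli
  have hc : c + k • a ≠ 0 := hli.ne_zero 1
  obtain ⟨p, q, r, hp, hq, h1, h2, h3, h4⟩ := exists_smul_inner_eq hli
  rw [inner_smul_left, inner_smul_right, h0, mul_zero, mul_zero] at h3
  -- By orthogonality the number r supplied by `exists_smul_inner_eq` is 0.
  rw [← h3, smul_add, smul_smul] at h4
  rw [smul_add, smul_smul] at h2
  refine ⟨p, q, q * k, hp, hq, h1, h2, ?_, h4⟩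
  rw [← inner_conj_symm, h4, map_zero]

/-! ### Existence of a basis of some type -/

namespace SubproductSystem

open NormalForm

section Existence

variable (S : SubproductSystem.{u})

/-- The image of `β_{1,1}`. -/
def relations : Submodule ℂ (S.E 1 ⊗[ℂ] S.E 1) :=
  LinearMap.range (S.β (rfl : (1 : ℕ+) + 1 = 1 + 1)).toLinearMap

variable {S}

theorem mem_relations_smul_iff {w : S.E 1 ⊗[ℂ] S.E 1} {s : ℂ} (hs : s ≠ 0) :
    s • w ∈ S.relations ↔ w ∈ S.relations :=
  Submodule.smul_mem_iff _ hs

theorem hasBasisOfType_of_pair {τ : NormalForm} {x y : S.E 1} (hxx : ⟪x, x⟫_ℂ = gram τ 1 0 0)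
    (hyy : ⟪y, y⟫_ℂ = gram τ 1 1 1) (hxy : ⟪x, y⟫_ℂ = gram τ 1 0 1)
    (hyx : ⟪y, x⟫_ℂ = gram τ 1 1 0)
    (h : ∀ i, tensorComb (coef τ 1 i) ![x, y] ![x, y] ∈ S.relations) : S.HasBasisOfType τ := by
  refine S.hasBasisOfType_of_one (e₁ := ![x, y]) ?_ h
  rw [Fin.forall_fin_two, Fin.forall_fin_two, Fin.forall_fin_two]
  exact ⟨⟨hxx, hxy⟩, hyx, hyy⟩

theorem exists_hasBasisOfType_of_tmul_self {a c : S.E 1} (hac : LinearIndependent ℂ ![a, c])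
    (ha : a ⊗ₜ[ℂ] a ∈ S.relations) (hc : c ⊗ₜ[ℂ] c ∈ S.relations) :
    ∃ τ, S.HasBasisOfType τ := by
  obtain ⟨p, q, r, hp, hq, h1, h2, h3, h4⟩ := exists_smul_inner_eq hac
  refine ⟨.E₁ r, hasBasisOfType_of_pair (h1.trans (by simp [gram]))
    (h2.trans (by simp [gram])) (h3.trans (by simp [gram])) (h4.trans (by simp [gram]))
    fun i => ?_⟩
  · fin_cases i <;> simp [-TensorProduct.tmul_smul, tensorComb, coef, TensorProduct.smul_tmul_smul] <;>
      exact Submodule.smul_mem _ _ (by assumption)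

theorem exists_hasBasisOfType_of_tmul_swap {a c : S.E 1} (hac : LinearIndependent ℂ ![a, c])
    (ha : a ⊗ₜ[ℂ] c ∈ S.relations) (hc : c ⊗ₜ[ℂ] a ∈ S.relations) :
    ∃ τ, S.HasBasisOfType τ := by
  obtain ⟨p, q, r, hp, hq, h1, h2, h3, h4⟩ := exists_smul_inner_eq hac
  refine ⟨.E₂ r, hasBasisOfType_of_pair (h1.trans (by simp [gram]))
    (h2.trans (by simp [gram])) (h3.trans (by simp [gram])) (h4.trans (by simp [gram]))
    fun i => ?_⟩
  · fin_cases i <;> simp [-TensorProduct.tmul_smul, tensorComb, coef, TensorProduct.smul_tmul_smul] <;>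
      exact Submodule.smul_mem _ _ (by assumption)

theorem exists_hasBasisOfType_of_commutation {a c : S.E 1} (hac : LinearIndependent ℂ ![a, c])
    {lam : ℂ} (hlam : lam ≠ 0) (ha : a ⊗ₜ[ℂ] a ∈ S.relations)
    (hc : lam • (a ⊗ₜ[ℂ] c) + c ⊗ₜ[ℂ] a ∈ S.relations) : ∃ τ, S.HasBasisOfType τ := by
  obtain ⟨p, q, r, hp, hq, h1, h2, h3, h4⟩ := exists_orthonormal_of_linearIndependent hac
  refine ⟨.E₃ ⟨lam, hlam⟩, hasBasisOfType_of_pair (h1.trans (by simp [gram]))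
    (h2.trans (by simp [gram])) (h3.trans (by simp [gram])) (h4.trans (by simp [gram]))
    fun i => ?_⟩
  · fin_cases i
    · simp [-TensorProduct.tmul_smul, tensorComb, coef, TensorProduct.smul_tmul_smul]
      exact Submodule.smul_mem _ _ ha
    -- Replacing c by q c + r a alters the commutation relation only by a multiple of a ⊗ a, itself
    -- a relation; hence Gram–Schmidt is allowed.
    · have : tensorComb (coef (.E₃ ⟨lam, hlam⟩) 1 1) ![p • a, q • c + r • a]
          ![p • a, q • c + r • a] = (p * q) • (lam • (a ⊗ₜ[ℂ] c) + c ⊗ₜ[ℂ] a) +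
            ((lam + 1) * p * r) • (a ⊗ₜ[ℂ] a) := by
        simp [tensorComb, coef, ← TensorProduct.smul_tmul', TensorProduct.add_tmul,
          TensorProduct.tmul_add]
        module
      change tensorComb (coef (.E₃ ⟨lam, hlam⟩) 1 1) _ _ ∈ _
      rw [this]
      exact Submodule.add_mem _ (Submodule.smul_mem _ _ hc) (Submodule.smul_mem _ _ ha)

theorem exists_hasBasisOfType_of_tmul_right {b d : S.E 1} (hbd : LinearIndependent ℂ ![b, d])
    (h : ∀ v, v ⊗ₜ[ℂ] b ∈ S.relations) : ∃ τ, S.HasBasisOfType τ := by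
  obtain ⟨p, q, r, hp, hq, h1, h2, h3, h4⟩ := exists_orthonormal_of_linearIndependent hbd
  refine ⟨.E₄, hasBasisOfType_of_pair (h1.trans (by simp [gram]))
    (h2.trans (by simp [gram])) (h3.trans (by simp [gram])) (h4.trans (by simp [gram]))
    fun i => ?_⟩
  · fin_cases i <;> simp only [tensorComb, coef, Fin.sum_univ_two] <;> simp <;>
      exact Submodule.smul_mem _ _ (h _)

theorem exists_hasBasisOfType_of_tmul_left {a c : S.E 1} (hac : LinearIndependent ℂ ![a, c])
    (h : ∀ v, a ⊗ₜ[ℂ] v ∈ S.relations) : ∃ τ, S.HasBasisOfType τ := by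
  obtain ⟨p, q, r, hp, hq, h1, h2, h3, h4⟩ := exists_orthonormal_of_linearIndependent hac
  have h' : ∀ v, (p • a) ⊗ₜ[ℂ] v ∈ S.relations := fun v => by
    rw [← TensorProduct.smul_tmul']
    exact Submodule.smul_mem _ _ (h v)
  refine ⟨.E₅, hasBasisOfType_of_pair (h1.trans (by simp [gram]))
    (h2.trans (by simp [gram])) (h3.trans (by simp [gram])) (h4.trans (by simp [gram]))
    fun i => ?_⟩
  · fin_cases i <;> simpa [-TensorProduct.tmul_smul, tensorComb, coef] using h' _

/-- The equations imposed on `β_{1,1}` by `E_3` being two-dimensional. -/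
theorem exists_coordinates_three {e : Fin 2 → S.E 1} {f : Fin 2 → S.E (1 + 1)}
    (he : LinearIndependent ℂ e) (hf : LinearIndependent ℂ f) {c : Fin 2 → Fin 2 → Fin 2 → ℂ}
    (hc : ∀ i, S.β rfl (f i) = tensorComb (c i) e e) (u : Fin 2 → Fin 2 → ℂ) :
    ∃ P Q : Fin 2 → Fin 2 → ℂ, Q ≠ 0 ∧ ∑ m, ∑ l, u m l * Q m l = 0 ∧
      ∀ j k l, ∑ i, P j i * c i k l = ∑ m, Q m l * c m j k := by
  have hz : ∃ z : S.E (1 + 1 + 1), z ≠ 0 ∧ ∃ Q : Fin 2 → Fin 2 → ℂ,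
      S.β rfl z = tensorComb Q f e ∧ ∑ m, ∑ l, u m l * Q m l = 0 := by
    have : Module.Finite ℂ (S.E (1 + 1 + 1)) :=
      Module.finite_of_finrank_pos (by simp [S.finrank_eq_two])
    let g := Module.finBasisOfFinrankEq ℂ _ (S.finrank_eq_two (1 + 1 + 1))
    choose Q hQ using fun i => exists_eq_tensorComb (S.finrank_eq_two (1 + 1))
      (S.finrank_eq_two 1) hf he (S.β rfl (g i))
    -- On the plane E_3 the functional u has a nonzero kernel vector. Leaving u arbitrary is how the
    -- full dimension 2, and not merely E_3 ≠ 0, gets used.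
    set ℓ : Fin 2 → ℂ := fun i => ∑ m, ∑ l, u m l * Q i m l with hℓ
    have key : ∀ α : Fin 2 → ℂ, α ≠ 0 → ∑ i, α i * ℓ i = 0 → ∃ z : S.E (1 + 1 + 1), z ≠ 0 ∧
        ∃ Q : Fin 2 → Fin 2 → ℂ, S.β rfl z = tensorComb Q f e ∧
          ∑ m, ∑ l, u m l * Q m l = 0 := by
      intro α hα h
      refine ⟨∑ i, α i • g i, fun h0 =>
        hα (funext (Fintype.linearIndependent_iff.1 g.linearIndependent α h0)),
        fun m l => ∑ i, α i * Q i m l, ?_, ?_⟩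
      · simp only [map_sum, map_smul, hQ, sum_smul_tensorComb]
      · rw [← h]
        simp only [hℓ, Fin.sum_univ_two]
        ring
    by_cases h0 : ℓ 0 = 0
    · exact key ![1, 0] (fun h => by simpa using congrFun h 0) (by simp [h0])
    · exact key ![ℓ 1, -ℓ 0] (fun h => h0 (by simpa using congrFun h 1)) (by simp; ring)
  obtain ⟨z, hz, Q, hQ, hu⟩ := hz
  obtain ⟨P, hP⟩ := exists_eq_tensorComb (S.finrank_eq_two 1) (S.finrank_eq_two (1 + 1)) he hf
    (S.β (add_assoc 1 1 1).symm z)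
  refine ⟨P, Q, fun h0 => hz ?_, hu,
    S.assoc_coordinates rfl rfl rfl (add_assoc 1 1 1).symm he he he hc hc hP hQ⟩
  refine S.β_injective rfl (a₁ := z) (a₂ := 0) ?_
  rw [hQ, h0, map_zero]
  simp [tensorComb]

/-- Row Q_0 is a multiple of b if b_0 ≠ 0 and of d if b_1 ≠ 0; row Q_1 likewise, according to d_0
and d_1. If b_0 and b_1 were both nonzero, Q_0 would vanish and Q_1 would range over at most a line,
on which some coordinate functional u is injective, a contradiction. The same argument applies to d,
and the determinant excludes the other combinations of zeros. -/
theorem diagonal_pencil_cases {b d : Fin 2 → ℂ} (hbd : b 0 * d 1 - b 1 * d 0 ≠ 0)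
    (h : ∀ u : Fin 2 → Fin 2 → ℂ, ∃ P Q : Fin 2 → Fin 2 → ℂ, Q ≠ 0 ∧
      ∑ m, ∑ l, u m l * Q m l = 0 ∧ ∀ j k l, ∑ i, P j i * ![![b, 0], ![0, d]] i k l =
        ∑ m, Q m l * ![![b, 0], ![0, d]] m j k) :
    b 1 = 0 ∧ d 0 = 0 ∨ b 0 = 0 ∧ d 1 = 0 := by
  have hQ : ∀ Q : Fin 2 → Fin 2 → ℂ, Q 0 0 = 0 → Q 0 1 = 0 → Q 1 0 = 0 → Q 1 1 = 0 → Q = 0 :=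
    fun Q h1 h2 h3 h4 => by
      ext i j
      fin_cases i <;> fin_cases j <;> assumption
  have hu : ∀ u : Fin 2 → Fin 2 → ℂ, ∃ P Q : Fin 2 → Fin 2 → ℂ, Q ≠ 0 ∧
      u 0 0 * Q 0 0 + u 0 1 * Q 0 1 + (u 1 0 * Q 1 0 + u 1 1 * Q 1 1) = 0 ∧
      (∀ l, P 0 0 * b l = Q 0 l * b 0) ∧ (∀ l, P 0 1 * d l = Q 0 l * b 1) ∧
      (∀ l, P 1 0 * b l = Q 1 l * d 0) ∧ (∀ l, P 1 1 * d l = Q 1 l * d 1) := fun u => by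
    obtain ⟨P, Q, h0, h1, h2⟩ := h u
    refine ⟨P, Q, h0, by simpa using h1, fun l => ?_, fun l => ?_, fun l => ?_, fun l => ?_⟩
    · simpa using h2 0 0 l
    · simpa using h2 0 1 l
    · simpa using h2 1 0 l
    · simpa using h2 1 1 l
  have hb : b 0 = 0 ∨ b 1 = 0 := by
    by_contra! hb
    by_cases hd : d 0 = 0
    · obtain ⟨P, Q, h0, h1, h2, h3, h4, h5⟩ := hu ![0, ![0, 1]]
      simp [Fin.forall_fin_two] at h1 h2 h3 h4 h5
      exact h0 (hQ Q (by grind) (by grind) (by grind) (by grind))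
    · obtain ⟨P, Q, h0, h1, h2, h3, h4, h5⟩ := hu ![0, ![1, 0]]
      simp [Fin.forall_fin_two] at h1 h2 h3 h4 h5
      exact h0 (hQ Q (by grind) (by grind) (by grind) (by grind))
  have hd : d 0 = 0 ∨ d 1 = 0 := by
    by_contra! hd
    by_cases hb : b 0 = 0
    · obtain ⟨P, Q, h0, h1, h2, h3, h4, h5⟩ := hu ![![0, 1], 0]
      simp [Fin.forall_fin_two] at h1 h2 h3 h4 h5
      exact h0 (hQ Q (by grind) (by grind) (by grind) (by grind))
    · obtain ⟨P, Q, h0, h1, h2, h3, h4, h5⟩ := hu ![![1, 0], 0]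
      simp [Fin.forall_fin_two] at h1 h2 h3 h4 h5
      exact h0 (hQ Q (by grind) (by grind) (by grind) (by grind))
  grind

/-- If b_1 ≠ 0, then row Q_1 is a multiple of b, so P_11 d is too; independence gives P_11 = 0 and
Q_1 = 0. The same argument then kills P_01 and Q_0. Here one nonzero Q is already contradictory. -/
theorem jordan_pencil_eq_zero {b d : Fin 2 → ℂ} (hbd : b 0 * d 1 - b 1 * d 0 ≠ 0)
    (h : ∃ P Q : Fin 2 → Fin 2 → ℂ, Q ≠ 0 ∧ ∀ j k l, ∑ i, P j i * ![![b, 0], ![d, b]] i k l =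
        ∑ m, Q m l * ![![b, 0], ![d, b]] m j k) : b 1 = 0 := by
  by_contra hb
  obtain ⟨P, Q, hQ, h⟩ := h
  apply hQ
  have h00 : ∀ l, P 0 0 * b l + P 0 1 * d l = Q 0 l * b 0 + Q 1 l * d 0 := fun l => by
    simpa using h 0 0 l
  have h01 : ∀ l, P 0 1 * b l = Q 0 l * b 1 + Q 1 l * d 1 := fun l => by simpa using h 0 1 l
  have h10 : ∀ l, P 1 0 * b l + P 1 1 * d l = Q 1 l * b 0 := fun l => by simpa using h 1 0 l
  have h11 : ∀ l, P 1 1 * b l = Q 1 l * b 1 := fun l => by simpa using h 1 1 l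
  simp only [Fin.forall_fin_two] at h00 h01 h10 h11
  have hP11 : P 1 1 = 0 := by grind
  have hQ10 : Q 1 0 = 0 := by grind
  have hQ11 : Q 1 1 = 0 := by grind
  have hP01 : P 0 1 = 0 := by grind
  ext i j
  fin_cases i <;> fin_cases j <;> simp <;> grind

end Existence

theorem exists_normalForm (S : SubproductSystem.{u}) : ∃ τ, S.HasBasisOfType τ := by
  obtain ⟨f, a, b, c, d, hf, hac, hbd, h0, h1⟩ := pencil_normalForm (S.finrank_eq_two 1)
    (S.finrank_eq_two (1 + 1)) (S.β_injective (rfl : (1 : ℕ+) + 1 = 1 + 1))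
  change S.β rfl (f 0) = _ at h0
  have hR0 : a ⊗ₜ[ℂ] b ∈ S.relations := ⟨f 0, h0⟩
  obtain ⟨b', hb'⟩ := exists_eq_sum_smul (S.finrank_eq_two 1) hac b
  obtain ⟨d', hd'⟩ := exists_eq_sum_smul (S.finrank_eq_two 1) hac d
  have hdet : b' 0 * d' 1 - b' 1 * d' 0 ≠ 0 := by
    rw [hb', hd'] at hbd
    exact linearIndependent_pair_det b' d' hbd
  simp only [Fin.sum_univ_two, Matrix.cons_val_zero, Matrix.cons_val_one] at hb' hd'
  rcases h1 with h1 | h1 | h1 | h1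
  · have hR1 : c ⊗ₜ[ℂ] d ∈ S.relations := ⟨f 1, h1⟩
    have hc : ∀ i, S.β rfl (f i) =
        tensorComb ((![![b', 0], ![0, d']] : Fin 2 → Fin 2 → Fin 2 → ℂ) i) ![a, c] ![a, c] := by
      rw [Fin.forall_fin_two]
      refine ⟨h0.trans ?_, Eq.trans h1 ?_⟩
      · simp [tensorComb, hb', TensorProduct.tmul_add]
      · simp [tensorComb, hd', TensorProduct.tmul_add]
    rcases diagonal_pencil_cases hdet fun u => exists_coordinates_three hac hf hc u with
      ⟨h2, h3⟩ | ⟨h2, h3⟩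
    · have hb0 : b' 0 ≠ 0 := by rintro h; simp [h, h2] at hdet
      have hd1 : d' 1 ≠ 0 := by rintro h; simp [h, h3] at hdet
      rw [h2, zero_smul, add_zero] at hb'
      rw [h3, zero_smul, zero_add] at hd'
      rw [hb', TensorProduct.tmul_smul, mem_relations_smul_iff hb0] at hR0
      rw [hd', TensorProduct.tmul_smul, mem_relations_smul_iff hd1] at hR1
      exact exists_hasBasisOfType_of_tmul_self hac hR0 hR1
    · have hb1 : b' 1 ≠ 0 := by rintro h; simp [h, h2] at hdet
      have hd0 : d' 0 ≠ 0 := by rintro h; simp [h, h3] at hdet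
      rw [h2, zero_smul, zero_add] at hb'
      rw [h3, zero_smul, add_zero] at hd'
      rw [hb', TensorProduct.tmul_smul, mem_relations_smul_iff hb1] at hR0
      rw [hd', TensorProduct.tmul_smul, mem_relations_smul_iff hd0] at hR1
      exact exists_hasBasisOfType_of_tmul_swap hac hR0 hR1
  · have hR1 : c ⊗ₜ[ℂ] b ∈ S.relations := ⟨f 1, h1⟩
    refine exists_hasBasisOfType_of_tmul_right hbd fun v => ?_
    obtain ⟨α, rfl⟩ := exists_eq_sum_smul (S.finrank_eq_two 1) hac v
    simp only [Fin.sum_univ_two, Matrix.cons_val_zero, Matrix.cons_val_one,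
      TensorProduct.add_tmul, ← TensorProduct.smul_tmul']
    exact Submodule.add_mem _ (Submodule.smul_mem _ _ hR0) (Submodule.smul_mem _ _ hR1)
  · have hR1 : a ⊗ₜ[ℂ] d ∈ S.relations := ⟨f 1, h1⟩
    refine exists_hasBasisOfType_of_tmul_left hac fun v => ?_
    obtain ⟨α, rfl⟩ := exists_eq_sum_smul (S.finrank_eq_two 1) hbd v
    simp only [Fin.sum_univ_two, Matrix.cons_val_zero, Matrix.cons_val_one,
      TensorProduct.tmul_add, TensorProduct.tmul_smul]
    exact Submodule.add_mem _ (Submodule.smul_mem _ _ hR0) (Submodule.smul_mem _ _ hR1)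
  · have hR1 : a ⊗ₜ[ℂ] d + c ⊗ₜ[ℂ] b ∈ S.relations := ⟨f 1, h1⟩
    have hc : ∀ i, S.β rfl (f i) =
        tensorComb ((![![b', 0], ![d', b']] : Fin 2 → Fin 2 → Fin 2 → ℂ) i) ![a, c] ![a, c] := by
      rw [Fin.forall_fin_two]
      refine ⟨h0.trans ?_, Eq.trans h1 ?_⟩
      · simp [tensorComb, hb', TensorProduct.tmul_add]
      · simp [tensorComb, hb', hd', TensorProduct.tmul_add]
    have hb1 : b' 1 = 0 := by
      obtain ⟨P, Q, hQ, -, h⟩ := exists_coordinates_three hac hf hc 0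
      exact jordan_pencil_eq_zero hdet ⟨P, Q, hQ, h⟩
    have hb0 : b' 0 ≠ 0 := by rintro h; simp [h, hb1] at hdet
    have hd1 : d' 1 ≠ 0 := by rintro h; simp [h, hb1] at hdet
    rw [hb1, zero_smul, add_zero] at hb'
    rw [hb', TensorProduct.tmul_smul, mem_relations_smul_iff hb0] at hR0
    -- With b = b'_0 a and d = d'_0 a + d'_1 c, the second relation is d'_0 a ⊗ a + d'_1 a ⊗ c +
    -- b'_0 c ⊗ a. Removing the a ⊗ a term and dividing by b'_0 gives λ = d'_1 / b'_0.
    refine exists_hasBasisOfType_of_commutation hac (div_ne_zero hd1 hb0) hR0 ?_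
    rw [← mem_relations_smul_iff hb0]
    have h2 := Submodule.sub_mem _ hR1 (Submodule.smul_mem _ (d' 0) hR0)
    convert h2 using 1
    rw [hb', hd', TensorProduct.tmul_add, TensorProduct.tmul_smul, TensorProduct.tmul_smul,
      TensorProduct.tmul_smul, smul_add, smul_smul, mul_div_cancel₀ _ hb0]
    module

end SubproductSystem

theorem mainTheorem1 :
    -- every subproduct system has a basis, and all its bases have the same type
    (∀ S : SubproductSystem.{u}, ∃! τ : SubproductSystem.NormalForm, S.HasBasisOfType τ) ∧
    -- for each type a system having a basis of that type exists
    (∀ τ : SubproductSystem.NormalForm, ∃ S : SubproductSystem.{v}, S.HasBasisOfType τ) ∧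
    -- such a system is unique up to isomorphism
    (∀ (τ : SubproductSystem.NormalForm) (S : SubproductSystem.{u}) (T : SubproductSystem.{v}),
      S.HasBasisOfType τ → T.HasBasisOfType τ → S.IsIsomorphic T) ∧
    -- systems of different types are not isomorphic
    (∀ (τ σ : SubproductSystem.NormalForm) (S : SubproductSystem.{u}) (T : SubproductSystem.{v}),
      S.HasBasisOfType τ → T.HasBasisOfType σ → τ ≠ σ → ¬ S.IsIsomorphic T) ∧
    -- hence, for any choice of representatives of the listed systems, every subproduct system is
    -- isomorphic to one and only one of them
    (∀ M : SubproductSystem.NormalForm → SubproductSystem.{v}, (∀ τ, (M τ).HasBasisOfType τ) →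
      ∀ S : SubproductSystem.{u}, ∃! τ : SubproductSystem.NormalForm, S.IsIsomorphic (M τ)) := by
  refine ⟨fun S => ?_, fun τ => SubproductSystem.exists_hasBasisOfType τ,
    fun τ S T => SubproductSystem.isIsomorphic_of_hasBasisOfType,
    fun τ σ S T hS hT hne h => hne ((hS.of_iso h).unique hT), fun M hM S => ?_⟩
  · obtain ⟨τ, hτ⟩ := S.exists_normalForm
    exact ⟨τ, hτ, fun σ hσ => hσ.unique hτ⟩
  · obtain ⟨τ, hτ⟩ := S.exists_normalForm
    exact ⟨τ, SubproductSystem.isIsomorphic_of_hasBasisOfType hτ (hM τ),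
      fun σ hσ => (hM σ).unique (hτ.of_iso hσ)⟩
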